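/- For $n\in\mathbb N=\{1,2,\dots\}$ let $$h_n(t)=\frac1{\sqrt{2n}}\sum_{k=0}^{n-1}\varphi_k\Big(\sqrt{\tfrac n2}\,t\Big)^2,\qquad \varphi_k(t)=(2^kk!\sqrt\pi)^{-1/2}H_k(t)e^{-t^2/2},\qquad H_k(t)=(-1)^ke^{t^2}\frac{d^k}{dt^k}e^{-t^2},$$ be the spectral density of a $\mathrm{GUE}(n,\frac1n)$ random matrix, and let $G_n(\lambda)=\int_{\mathbb R}\frac{h_n(t)}{\lambda-t}\,dt$, $\lambda\in\mathbb C\setminus\mathbb R$, be its Cauchy transform. For a $C^\infty$-function $g\colon\mathbb R\to\mathbb C$ let $Sg$ be the unique $C^\infty$-function $f\colon\mathbb R\to\mathbb C$ with $$g(t)=\frac1{2\pi}\int_{-2}^2g(s)\sqrt{4-s^2}\,ds+(t^2-4)f'(t)+3tf(t)\qquad(t\in\mathbb R)$$ (if all derivatives of $g$, including $g$ itself, are bounded, then the same holds for $f$), and put $Tg=(Sg)'''$. For $\lambda\in\mathbb C\setminus\mathbb R$ and $j\ge0$ put $g_\lambda(t)=\frac1{\lambda-t}$ and $$\eta_j(\lambda)=\frac1{2\pi}\int_{-2}^2[T^jg_\lambda](t)\sqrt{4-t^2}\,dt.$$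 Write $(\lambda^2-4)^{1/2}=\lambda\sqrt{1-4/\lambda^2}$, with the principal branch of $\sqrt{\cdot}$ on $\mathbb C\setminus(-\infty,0]$, and $(\lambda^2-4)^{m/2}=\big((\lambda^2-4)^{1/2}\big)^m$ for odd integers $m$. Proposition. For all $\lambda\in\mathbb C\setminus\mathbb R$ and $k\in\mathbb N_0$, $$G_n(\lambda)=\eta_0(\lambda)+\frac{\eta_1(\lambda)}{n^2}+\cdots+\frac{\eta_k(\lambda)}{n^{2k}}+O(n^{-2k-2})\qquad(n\in\mathbb N),$$ where the implied constant may depend on $\lambda$ and $k$ but not on $n$. For all $\lambda\in\mathbb C\setminus\mathbb R$, $$\eta_0(\lambda)=\frac\lambda2-\frac12(\lambda^2-4)^{1/2},\qquad \eta_1(\lambda)=(\lambda^2-4)^{-5/2}.$$ Moreover, there are real constants $C_{j,r}$ ($j\ge1$, $2j\le r\le 3j-1$), not depending on $\lambda$, such that for all $j\ge1$ and $\lambda\in\mathbb C\setminus\mathbb R$ $$\eta_j(\lambda)=\sum_{r=2j}^{3j-1}C_{j,r}(\lambda^2-4)^{-r-1/2},$$ and such that for all $j\ge1$ and $2j+2\le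 r\le 3j+2$ $$C_{j+1,r}=\frac{(2r-3)(2r-1)}{r+1}\Big((r-1)C_{j,r-2}+(4r-10)C_{j,r-3}\Big),$$ with the conventions $C_{j,2j-1}=0=C_{j,3j}$. -/

import Mathlib

open scoped ContDiff

noncomputable section

namespace GUEExpansion

/-- The (physicists') Hermite polynomial
`H_k(t) = (-1)^k exp(t^2) (d^k/dt^k) exp(-t^2)`, as a function on `ℝ`. -/
def hermiteH (k : ℕ) (t : ℝ) : ℝ :=
  (-1) ^ k * Real.exp (t ^ 2) * iteratedDeriv k (fun s : ℝ => Real.exp (-s ^ 2)) t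

/-- The Hermite function `φ_k(t) = (2^k k! √π)^{-1/2} H_k(t) exp(-t^2/2)`. -/
def hermiteFun (k : ℕ) (t : ℝ) : ℝ :=
  (Real.sqrt (2 ^ k * (Nat.factorial k : ℝ) * Real.sqrt Real.pi))⁻¹ *
    hermiteH k t * Real.exp (-t ^ 2 / 2)

/-- The spectral density of a `GUE(n, 1/n)` random matrix (`n ≥ 1`):
`h_n(t) = (2n)^{-1/2} ∑_{k=0}^{n-1} φ_k(√(n/2) t)^2`. -/
def gueDensity (n : ℕ) (t : ℝ) : ℝ :=
  (Real.sqrt (2 * n))⁻¹ *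
    ∑ k ∈ Finset.range n, hermiteFun k (Real.sqrt ((n : ℝ) / 2) * t) ^ 2

/-- The function `g_z(t) = 1 / (z - t)` on `ℝ`. -/
def resolventFun (z : ℂ) (t : ℝ) : ℂ := 1 / (z - (t : ℂ))

/-- The Cauchy transform `G_n(z) = ∫ h_n(t) / (z - t) dt`. -/
def cauchyTransform (n : ℕ) (z : ℂ) : ℂ :=
  ∫ t : ℝ, resolventFun z t * (gueDensity n t : ℂ)

/-- The semicircular mean `(1 / 2π) ∫_{-2}^{2} g(s) √(4 - s^2) ds`. -/
def semicircleMean (g : ℝ → ℂ) : ℂ :=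
  1 / (2 * (Real.pi : ℂ)) * ∫ s in (-2 : ℝ)..2, g s * (Real.sqrt (4 - s ^ 2) : ℂ)

/-- `f : ℝ → ℂ` is a smooth solution of
`g(t) = (1 / 2π) ∫_{-2}^{2} g(s) √(4 - s^2) ds + (t^2 - 4) f'(t) + 3 t f(t)` on `ℝ`. -/
def SolvesAux (g f : ℝ → ℂ) : Prop :=
  ContDiff ℝ ∞ f ∧
    ∀ t : ℝ, g t = semicircleMean g + ((t : ℂ) ^ 2 - 4) * deriv f t + 3 * (t : ℂ) * f t

open Classical in
/-- The operator `S`: for smooth `g`, `S g` is the unique smooth solution `f` of the equation in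
`SolvesAux`; it maps the space `C_b^∞(ℝ)` of smooth functions with all derivatives bounded into
itself. The value `0` is used only when there is no solution. -/
def opS (g : ℝ → ℂ) : ℝ → ℂ :=
  if h : ∃ f : ℝ → ℂ, SolvesAux g f then h.choose else 0

/-- The operator `T g = (S g)'''`. -/
def opT (g : ℝ → ℂ) : ℝ → ℂ := iteratedDeriv 3 (opS g)

/-- The coefficient `η_j(z) = (1 / 2π) ∫_{-2}^{2} [T^j g_z](s) √(4 - s^2) ds`. -/
def eta (j : ℕ) (z : ℂ) : ℂ := semicircleMean (opT^[j] (resolventFun z))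

/-- The branch `(z^2 - 4)^{1/2} = z √(1 - 4 / z^2)` on `ℂ ∖ [-2, 2]`, where `√` is the principal
branch of the square root. -/
def sqrtBranch (z : ℂ) : ℂ := z * (1 - 4 / z ^ 2) ^ (1 / 2 : ℂ)

end GUEExpansion

end

/-!
The proof compares the expectation `∫ g h_n` with the semicircular mean of `g` through the
first-order operator `L f = (t² - 4) f' + 3 t f` (`opL`).

The density `h_n` is a polynomial times a Gaussian and satisfies
`n⁻² h_n''' + (4 - t²) h_n' + t h_n = 0` (`guePoly_ode`); this is algebra with Hermite polynomials,
starting from the Christoffel–Darboux formula on the diagonal (`christoffelSum_succ`). Integration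
by parts turns it into `∫ (L f) h_n = n⁻² ∫ f''' h_n` (`gueMean_opL`). Applied to `f = S g`, for
which `L f = g - mean g`, this gives `∫ g h_n = mean g + n⁻² ∫ (T g) h_n`, and iteration gives the
expansion. The remainder is `n^{-2k-2} ∫ (T^{k+1} g) h_n`, which is `O(n^{-2k-2})` because `T`
preserves the smooth functions with bounded derivatives and `h_n` is a probability density.

That `S` is well defined and bounded rests on two facts. A maximum principle
(`norm_le_of_singular_ode`), applied to the equation satisfied by each derivative of `f`, bounds
`f` and its derivatives by those of `L f` (`exists_derivBound_of_opL`); in particular it gives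
uniqueness. For existence, `f = (t + 2)^{-3/2} y` turns `L f = h` near the singular point `2` into
an Euler equation for `y`, solved by an average over the segment from `2` to `t` that is visibly
smooth; the point `-2` is symmetric, and the two solutions agree on `(-2, 2)` exactly because `h`
has semicircular mean zero (`exists_solvesAux`).

The coefficients are found without computing `T^j g_z`. Write `g_z'` for the derivative in `t`. One
has `L g_z = (z² - 4) g_z' + z g_z - 2`, while `T` kills constants, `T (L f) = f'''` and the mean
of `L f` vanishes. The functionals `g ↦ mean (T^j g)` are continuous for the seminorms
`sup |g^{(i)}|`, so `η_j' (z) = -mean (T^j g_z')` (`BddFunctional.hasDerivAt_resolventFun`).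
Together these give `(z² - 4) η_0' - z η_0 = -2` and `(z² - 4) η_{j+1}' - z η_{j+1} = η_j'''`. The
solutions of the homogeneous equation are multiples of `(z² - 4)^{1/2}` and are excluded by
boundedness of `η_j` away from the real axis (`BddFunctional.apply_resolventFun_eq`), so it is
enough to check that the stated expressions solve these equations.
-/

namespace GUEExpansion

section Hermite

open Polynomial MeasureTheory

/-! ### Polynomials times a Gaussian -/

/-- The polynomial `p' - 2bXp`, so that `(p exp(-b t^2))' = (gaussDeriv b p) exp(-b t^2)`. -/
noncomputable def gaussDeriv (b : ℝ) (p : ℝ[X]) : ℝ[X] :=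
  derivative p - C (2 * b) * X * p

lemma gaussDeriv_one (p : ℝ[X]) : gaussDeriv 1 p = derivative p - 2 * X * p := by
  rw [gaussDeriv, mul_one]; rfl

lemma hasDerivAt_eval_mul_gauss (b : ℝ) (p : ℝ[X]) (t : ℝ) :
    HasDerivAt (fun t : ℝ => p.eval t * Real.exp (-b * t ^ 2))
      ((gaussDeriv b p).eval t * Real.exp (-b * t ^ 2)) t := by
  have h1 := p.hasDerivAt t
  have h2 : HasDerivAt (fun t : ℝ => Real.exp (-b * t ^ 2))
      (Real.exp (-b * t ^ 2) * (-b * (2 * t))) t := by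
    convert ((hasDerivAt_pow 2 t).const_mul (-b)).exp using 1
    norm_num
  refine (h1.fun_mul h2).congr_deriv ?_
  simp only [gaussDeriv, eval_sub, eval_mul, eval_C, eval_X]
  ring

lemma integrable_eval_mul_gauss {b : ℝ} (hb : 0 < b) (p : ℝ[X]) :
    Integrable (fun t : ℝ => p.eval t * Real.exp (-b * t ^ 2)) := by
  induction p using Polynomial.induction_on' with
  | add p q hp hq =>
    simp only [eval_add, add_mul]
    exact hp.add hq
  | monomial n a =>
    have h := integrable_rpow_mul_exp_neg_mul_sq hb (s := n)
      (lt_of_lt_of_le (by norm_num) (Nat.cast_nonneg n))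
    simp only [Real.rpow_natCast] at h
    simpa only [eval_monomial, mul_assoc] using h.const_mul a

lemma integral_gaussDeriv {b : ℝ} (hb : 0 < b) (p : ℝ[X]) :
    ∫ t : ℝ, (gaussDeriv b p).eval t * Real.exp (-b * t ^ 2) = 0 :=
  integral_eq_zero_of_hasDerivAt_of_integrable (hasDerivAt_eval_mul_gauss b p)
    (integrable_eval_mul_gauss hb _) (integrable_eval_mul_gauss hb _)

/-! ### Hermite polynomials -/

/-- The physicists' Hermite polynomials, by `H_0 = 1`, `H_{k+1} = 2 X H_k - H_k'`. -/
noncomputable def physHermite : ℕ → ℝ[X]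
  | 0 => 1
  | k + 1 => 2 * X * physHermite k - derivative (physHermite k)

lemma physHermite_succ_eq_neg_gaussDeriv (k : ℕ) :
    physHermite (k + 1) = -gaussDeriv 1 (physHermite k) := by
  rw [gaussDeriv_one, physHermite]
  ring

lemma iteratedDeriv_gauss (k : ℕ) (t : ℝ) :
    iteratedDeriv k (fun s : ℝ => Real.exp (-s ^ 2)) t =
      (-1) ^ k * ((physHermite k).eval t * Real.exp (-1 * t ^ 2)) := by
  induction k generalizing t with
  | zero => simp [physHermite]
  | succ k ih =>
    rw [iteratedDeriv_succ, funext ih,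
      ((hasDerivAt_eval_mul_gauss 1 (physHermite k) t).const_mul _).deriv,
      physHermite_succ_eq_neg_gaussDeriv, eval_neg]
    ring

lemma hermiteH_eq_eval (k : ℕ) (t : ℝ) : hermiteH k t = (physHermite k).eval t := by
  have h1 : Real.exp (t ^ 2) * Real.exp (-1 * t ^ 2) = 1 := by
    rw [← Real.exp_add]; simp
  have h2 : ((-1 : ℝ) ^ k) * (-1) ^ k = 1 := by
    rw [← mul_pow]; simp
  rw [hermiteH, iteratedDeriv_gauss]
  calc _ = ((-1) ^ k * (-1) ^ k) * (Real.exp (t ^ 2) * Real.exp (-1 * t ^ 2)) *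
        (physHermite k).eval t := by ring
    _ = _ := by rw [h1, h2]; ring

lemma derivative_physHermite_succ (k : ℕ) :
    derivative (physHermite (k + 1)) = 2 * ((k : ℝ[X]) + 1) * physHermite k := by
  induction k with
  | zero => simp [physHermite]
  | succ k ih =>
    have h : derivative (2 * ((k : ℝ[X]) + 1) * physHermite k) =
        2 * ((k : ℝ[X]) + 1) * derivative (physHermite k) := by
      simp [derivative_mul]
    rw [physHermite, derivative_sub, derivative_mul, ih, h]
    simp only [physHermite, derivative_mul, derivative_X, derivative_ofNat]
    push_cast
    ring

/-- The inverse squared norm `1 / (2^k k! √π)` of the `k`-th Hermite polynomial. -/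
noncomputable def hermiteNorm (k : ℕ) : ℝ :=
  (2 ^ k * (Nat.factorial k : ℝ) * Real.sqrt Real.pi)⁻¹

lemma hermiteNorm_succ (k : ℕ) :
    hermiteNorm (k + 1) * (2 * ((k : ℝ) + 1)) = hermiteNorm k := by
  have h1 : (0 : ℝ) < Real.sqrt Real.pi := Real.sqrt_pos.2 Real.pi_pos
  have h2 : (0 : ℝ) < Nat.factorial k := by exact_mod_cast k.factorial_pos
  rw [hermiteNorm, hermiteNorm, Nat.factorial_succ]
  push_cast
  field_simp
  ring

lemma hermiteFun_sq (k : ℕ) (t : ℝ) :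
    hermiteFun k t ^ 2 =
      hermiteNorm k * ((physHermite k ^ 2).eval t * Real.exp (-1 * t ^ 2)) := by
  have h1 : Real.exp (-t ^ 2 / 2) ^ 2 = Real.exp (-1 * t ^ 2) := by
    rw [← Real.exp_nat_mul]; congr 1; push_cast; ring
  rw [hermiteFun, mul_pow, mul_pow, h1, hermiteH_eq_eval, inv_pow, Real.sq_sqrt (by positivity),
    eval_pow, hermiteNorm]
  ring

/-- The squared norm of `H_k` in `L^2(exp(-t^2) dt)`, by the recursion
`∫ H_{k+1}^2 exp(-t^2) = ∫ H_{k+1}' H_k exp(-t^2)`. -/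
lemma integral_physHermite_sq (k : ℕ) :
    hermiteNorm k * ∫ t : ℝ, (physHermite k ^ 2).eval t * Real.exp (-1 * t ^ 2) = 1 := by
  induction k with
  | zero =>
    have h := integral_gaussian 1
    have h1 : (0 : ℝ) < Real.sqrt Real.pi := Real.sqrt_pos.2 Real.pi_pos
    simp only [physHermite, one_pow, eval_one, one_mul, h, div_one, hermiteNorm, pow_zero,
      Nat.factorial_zero, Nat.cast_one]
    exact inv_mul_cancel₀ h1.ne'
  | succ k ih =>
    have key : physHermite (k + 1) ^ 2 =
        C (2 * ((k : ℝ) + 1)) * physHermite k ^ 2 -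
          gaussDeriv 1 (physHermite k * physHermite (k + 1)) := by
      have h1 := physHermite_succ_eq_neg_gaussDeriv k
      have h2 := derivative_physHermite_succ k
      have h3 : C (2 * ((k : ℝ) + 1)) = 2 * ((k : ℝ[X]) + 1) := by
        rw [map_mul, map_add, map_natCast, map_one]; rfl
      rw [gaussDeriv_one] at h1 ⊢
      rw [derivative_mul, h2, h3]
      linear_combination (physHermite (k + 1)) * h1
    have h3 : ∫ t : ℝ, (physHermite (k + 1) ^ 2).eval t * Real.exp (-1 * t ^ 2) =
        2 * ((k : ℝ) + 1) * ∫ t : ℝ, (physHermite k ^ 2).eval t * Real.exp (-1 * t ^ 2) := by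
      have h4 := integral_gaussDeriv one_pos (physHermite k * physHermite (k + 1))
      rw [← integral_const_mul, ← sub_zero (∫ t : ℝ, 2 * ((k : ℝ) + 1) * _), ← h4,
        ← integral_sub ((integrable_eval_mul_gauss one_pos _).const_mul _)
          (integrable_eval_mul_gauss one_pos _), key]
      congr 1 with t
      simp only [eval_sub, eval_mul, eval_C, eval_pow]
      ring
    rw [h3, ← mul_assoc, hermiteNorm_succ, ih]

/-! ### The differential equation of the spectral density -/

/-- The polynomial factor `∑_{k<n} H_k^2 / (2^k k! √π)` of `∑_{k<n} φ_k^2`. -/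
noncomputable def christoffelSum (n : ℕ) : ℝ[X] :=
  ∑ k ∈ Finset.range n, C (hermiteNorm k) * physHermite k ^ 2

/-- The Christoffel–Darboux formula on the diagonal. -/
lemma christoffelSum_succ (n : ℕ) :
    christoffelSum (n + 1) = C (hermiteNorm n / 2) *
      ((2 * (n : ℝ[X]) + 2) * physHermite n ^ 2 + physHermite (n + 1) ^ 2
        - 2 * X * physHermite (n + 1) * physHermite n) := by
  induction n with
  | zero =>
    simp only [christoffelSum, physHermite, zero_add, Finset.sum_range_one, derivative_one]
    have : C (hermiteNorm 0) = C (hermiteNorm 0 / 2) * 2 := by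
      rw [← map_ofNat C 2, ← map_mul]; congr 1; ring
    rw [this]
    push_cast
    ring
  | succ n ih =>
    rw [christoffelSum, Finset.sum_range_succ, ← christoffelSum, ih]
    have h1 : C (hermiteNorm (n + 1)) = C (hermiteNorm (n + 1) / 2) * 2 := by
      rw [← map_ofNat C 2, ← map_mul]; congr 1; ring
    have h2 : C (hermiteNorm n / 2) =
        C (hermiteNorm (n + 1) / 2) * (2 * ((n : ℝ[X]) + 1)) := by
      rw [← hermiteNorm_succ, mul_div_right_comm, map_mul, map_mul, map_add, map_natCast,
        map_one]
      rfl
    have h3 : physHermite (n + 2) = 2 * X * physHermite (n + 1) -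
        2 * ((n : ℝ[X]) + 1) * physHermite n := by
      rw [physHermite, derivative_physHermite_succ]
    rw [h1, h2, h3]
    push_cast
    ring

lemma gaussDeriv_C_mul (b a : ℝ) (p : ℝ[X]) :
    gaussDeriv b (C a * p) = C a * gaussDeriv b p := by
  simp only [gaussDeriv, derivative_mul, derivative_C]
  ring

/-- In the unscaled variable, `y = ∑_{k<n} φ_k^2` satisfies `y''' + (8n - 4x^2) y' + 4xy = 0`. -/
lemma christoffelSum_ode (n : ℕ) :
    gaussDeriv 1 (gaussDeriv 1 (gaussDeriv 1 (christoffelSum n))) +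
      (8 * (n : ℝ[X]) - 4 * X ^ 2) * gaussDeriv 1 (christoffelSum n) +
      4 * X * christoffelSum n = 0 := by
  cases n with
  | zero => simp [christoffelSum, gaussDeriv]
  | succ n =>
    have h1 := derivative_physHermite_succ n
    have h2 : derivative (physHermite n) = 2 * X * physHermite n - physHermite (n + 1) := by
      rw [physHermite]; ring
    have h3 : derivative (2 * (n : ℝ[X]) + 2) = 0 := by simp
    have h4 : derivative ((n : ℝ[X]) + 1) = 0 := by simp
    rw [christoffelSum_succ]
    simp only [gaussDeriv_C_mul, gaussDeriv_one, pow_two, derivative_mul, derivative_add,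
      derivative_sub, derivative_X, derivative_ofNat, h1, h2, h3, h4, derivative_one,
      derivative_zero]
    push_cast
    ring

lemma gaussDeriv_comp_C_mul_X (a : ℝ) (p : ℝ[X]) :
    gaussDeriv (a ^ 2) (p.comp (C a * X)) = C a * (gaussDeriv 1 p).comp (C a * X) := by
  simp only [gaussDeriv, derivative_comp, derivative_mul, derivative_C, derivative_X, zero_mul,
    zero_add, mul_one, sub_comp, mul_comp, X_comp, C_comp, map_mul, map_pow]
  ring

/-- The polynomial factor of `gueDensity n`. -/
noncomputable def guePoly (n : ℕ) : ℝ[X] :=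
  C (Real.sqrt (2 * n))⁻¹ * (christoffelSum n).comp (C (Real.sqrt ((n : ℝ) / 2)) * X)

lemma gueDensity_eq (n : ℕ) (t : ℝ) :
    gueDensity n t = (guePoly n).eval t * Real.exp (-((n : ℝ) / 2) * t ^ 2) := by
  have h : -1 * (Real.sqrt ((n : ℝ) / 2) * t) ^ 2 = -((n : ℝ) / 2) * t ^ 2 := by
    rw [mul_pow, Real.sq_sqrt (by positivity)]; ring
  simp only [gueDensity, hermiteFun_sq, h, guePoly, christoffelSum, eval_mul, eval_C, eval_comp,
    eval_X, eval_finsetSum, Finset.sum_mul, mul_assoc]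

/-- The differential equation `n^{-2} h''' + (4 - t^2) h' + t h = 0` of `h = gueDensity n`. -/
lemma guePoly_ode {n : ℕ} (hn : 1 ≤ n) :
    C (((n : ℝ) ^ 2)⁻¹) * gaussDeriv (n / 2) (gaussDeriv (n / 2) (gaussDeriv (n / 2) (guePoly n))) +
      (4 - X ^ 2) * gaussDeriv (n / 2) (guePoly n) + X * guePoly n = 0 := by
  have hn0 : (0 : ℝ) < n := by exact_mod_cast hn
  set a := Real.sqrt ((n : ℝ) / 2) with ha
  have ha2 : a ^ 2 = (n : ℝ) / 2 := Real.sq_sqrt (by positivity)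
  have ha0 : a ≠ 0 := (Real.sqrt_pos.2 (by positivity)).ne'
  have key := congrArg (fun p : ℝ[X] => p.comp (C a * X)) (christoffelSum_ode n)
  have h8 : (8 : ℝ[X]).comp (C a * X) = 8 := C_comp
  have h4 : (4 : ℝ[X]).comp (C a * X) = 4 := C_comp
  simp only [add_comp, mul_comp, sub_comp, pow_comp, X_comp, natCast_comp, h8, h4,
    zero_comp] at key
  rw [guePoly, ← ha, ← ha2]
  simp only [gaussDeriv_C_mul, gaussDeriv_comp_C_mul_X]
  have hna : (n : ℝ) = 2 * a ^ 2 := by rw [ha2]; ring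
  have hnC : ((n : ℕ) : ℝ[X]) = 2 * C a ^ 2 := by
    rw [← map_natCast C n, hna, map_mul, map_pow]; rfl
  have hinv : C (((n : ℝ) ^ 2)⁻¹) * (4 * C a ^ 4) = 1 := by
    rw [hna, ← map_ofNat C 4, ← map_pow, ← map_mul, ← map_mul, ← map_one C]
    congr 1
    field_simp
    norm_num
  have hainv : C a * C a⁻¹ = 1 := by
    rw [← map_mul, mul_inv_cancel₀ ha0, map_one]
  rw [hnC] at key
  set D := (gaussDeriv 1 (christoffelSum n)).comp (C a * X)
  set D3 := (gaussDeriv 1 (gaussDeriv 1 (gaussDeriv 1 (christoffelSum n)))).comp (C a * X)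
  set Y := (christoffelSum n).comp (C a * X)
  set s := C (Real.sqrt (2 * (n : ℝ)))⁻¹
  set N := C (((n : ℝ) ^ 2)⁻¹)
  linear_combination (s * N * C a ^ 3) * key +
    s * (-(4 - X ^ 2) * C a * D - X * Y) * hinv

lemma gueDensity_nonneg (n : ℕ) (t : ℝ) : 0 ≤ gueDensity n t := by
  unfold gueDensity; positivity

lemma integrable_gueDensity {n : ℕ} (hn : 1 ≤ n) : Integrable (gueDensity n) := by
  have hn0 : (0 : ℝ) < n := by exact_mod_cast hn
  rw [funext (gueDensity_eq n)]
  exact integrable_eval_mul_gauss (by positivity) _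

lemma integral_gueDensity {n : ℕ} (hn : 1 ≤ n) : ∫ t : ℝ, gueDensity n t = 1 := by
  have hn0 : (0 : ℝ) < n := by exact_mod_cast hn
  have ha0 : 0 < Real.sqrt ((n : ℝ) / 2) := Real.sqrt_pos.2 (by positivity)
  have h1 : ∫ x : ℝ, ∑ k ∈ Finset.range n, hermiteFun k x ^ 2 = n := by
    simp only [hermiteFun_sq]
    rw [integral_finsetSum _ fun k _ => (integrable_eval_mul_gauss one_pos _).const_mul _]
    simp [integral_const_mul, integral_physHermite_sq, -eval_pow, -neg_mul]
  have h2 : Real.sqrt (2 * n) * Real.sqrt ((n : ℝ) / 2) = n := by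
    rw [← Real.sqrt_mul (by positivity), show (2 * (n : ℝ)) * (n / 2) = n ^ 2 by ring,
      Real.sqrt_sq hn0.le]
  simp only [gueDensity]
  rw [integral_const_mul, Measure.integral_comp_mul_left
    (fun x : ℝ => ∑ k ∈ Finset.range n, hermiteFun k x ^ 2), h1, abs_of_pos (inv_pos.2 ha0),
    smul_eq_mul]
  rw [← mul_assoc, ← mul_inv, h2, inv_mul_cancel₀ hn0.ne']

end Hermite

open MeasureTheory Set Filter Topology Bornology

/-! ### A maximum principle -/

/-- A maximum principle for `p v' + q v = r` on `[a, b]`, with `p(a) ≤ 0 ≤ p(b)` and `q ≥ q₀ > 0`: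
at a maximum of `‖v‖²` the first-order term has a favourable sign. -/
lemma norm_le_div_of_ode {a b : ℝ} (hab : a ≤ b) {v v' r : ℝ → ℂ} {p q : ℝ → ℝ} {q₀ R : ℝ}
    (hq₀ : 0 < q₀) (hv : ∀ t, HasDerivAt v (v' t) t)
    (hode : ∀ t ∈ Icc a b, (p t : ℂ) * v' t + (q t : ℂ) * v t = r t)
    (hq : ∀ t ∈ Icc a b, q₀ ≤ q t) (hpa : p a ≤ 0) (hpb : 0 ≤ p b)
    (hr : ∀ t ∈ Icc a b, ‖r t‖ ≤ R) : ∀ t ∈ Icc a b, ‖v t‖ ≤ R / q₀ := by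
  have hφ : ∀ t, HasDerivAt (fun t => ‖v t‖ ^ 2) (2 * inner ℝ (v t) (v' t)) t :=
    fun t => (hv t).norm_sq
  have hcont : ContinuousOn (fun t => ‖v t‖ ^ 2) (Icc a b) :=
    fun t _ => (hφ t).continuousAt.continuousWithinAt
  obtain ⟨m, hm, hmax⟩ := isCompact_Icc.exists_isMaxOn (nonempty_Icc.2 hab) hcont
  have hsign : 0 ≤ p m * (2 * inner ℝ (v m) (v' m)) := by
    have hdir : ∀ y ∈ Icc a b, (y - m) * (2 * inner ℝ (v m) (v' m)) ≤ 0 := by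
      intro y hy
      have := hmax.localize.hasFDerivWithinAt_nonpos (hφ m).hasFDerivAt.hasFDerivWithinAt
        (sub_mem_posTangentConeAt_of_segment_subset
          ((convex_Icc a b).segment_subset hm hy))
      simpa using this
    have ha := hdir a (left_mem_Icc.2 hab)
    have hb := hdir b (right_mem_Icc.2 hab)
    rcases eq_or_lt_of_le hm.1 with h1 | h1
    · rw [← h1] at hb ⊢
      rcases hab.eq_or_lt with h2 | h2
      · rw [le_antisymm hpa (h2 ▸ hpb), zero_mul]
      · exact mul_nonneg_of_nonpos_of_nonpos hpa
          (nonpos_of_mul_nonpos_right hb (sub_pos.2 h2))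
    · rcases eq_or_lt_of_le hm.2 with h2 | h2
      · rw [h2] at ha ⊢
        exact mul_nonneg hpb (nonneg_of_mul_nonpos_right ha (by linarith))
      · have : IsLocalMax (fun t => ‖v t‖ ^ 2) m :=
          hmax.isLocalMax (Icc_mem_nhds h1 h2)
        rw [this.hasDerivAt_eq_zero (hφ m), mul_zero]
  have hinner : p m * inner ℝ (v m) (v' m) + q m * ‖v m‖ ^ 2 = inner ℝ (v m) (r m) := by
    rw [← hode m hm, inner_add_right, ← Complex.real_smul, ← Complex.real_smul,
      real_inner_smul_right, real_inner_smul_right, real_inner_self_eq_norm_sq]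
  have hle : inner ℝ (v m) (r m) ≤ ‖v m‖ * R :=
    (real_inner_le_norm _ _).trans (mul_le_mul_of_nonneg_left (hr m hm) (norm_nonneg _))
  have hvm : ‖v m‖ ≤ R / q₀ := by
    have hR : 0 ≤ R := (norm_nonneg _).trans (hr m hm)
    rcases (norm_nonneg (v m)).eq_or_lt with h0 | h0
    · rw [← h0]; positivity
    · rw [le_div_iff₀ hq₀]
      have h1 : q₀ * ‖v m‖ ^ 2 ≤ q m * ‖v m‖ ^ 2 :=
        mul_le_mul_of_nonneg_right (hq m hm) (sq_nonneg _)
      nlinarith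
  intro t ht
  have h1 : ‖v t‖ ^ 2 ≤ ‖v m‖ ^ 2 := hmax ht
  exact (pow_le_pow_iff_left₀ (norm_nonneg _) (norm_nonneg _) two_ne_zero).1 h1 |>.trans hvm

/-- An a priori bound for `(t² - 4) u' + c t u = r` on the whole line. -/
lemma norm_le_of_singular_ode {u u' r : ℝ → ℂ} {c R : ℝ} (hc : 0 < c)
    (hu : ∀ t, HasDerivAt u (u' t) t)
    (hode : ∀ t : ℝ, ((t : ℂ) ^ 2 - 4) * u' t + c * t * u t = r t)
    (hr : ∀ t, ‖r t‖ ≤ R) (t : ℝ) : ‖u t‖ ≤ Real.exp (3 * c) / (2 * c) * R := by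
  have hR : 0 ≤ R := (norm_nonneg _).trans (hr 0)
  -- by the symmetry `u(t) ↦ -u(-t)` it suffices to treat `t ≥ -1`
  have main : ∀ (u u' r : ℝ → ℂ), (∀ t, HasDerivAt u (u' t) t) →
      (∀ t : ℝ, ((t : ℂ) ^ 2 - 4) * u' t + c * t * u t = r t) → (∀ t, ‖r t‖ ≤ R) →
      ∀ t, -1 ≤ t → ‖u t‖ ≤ Real.exp (3 * c) / (2 * c) * R := by
    intro u u' r hu hode hr t ht
    rcases le_total t 2 with h2 | h2
    · -- on `[-1, 2]` the multiplier `exp (c t)` makes the zeroth-order coefficient at least `2c`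
      have hv : ∀ s : ℝ, HasDerivAt (fun s : ℝ => (Real.exp (c * s) : ℂ) * u s)
          ((Real.exp (c * s) * c : ℝ) * u s + (Real.exp (c * s) : ℂ) * u' s) s := by
        intro s
        have h1 : HasDerivAt (fun s : ℝ => Real.exp (c * s)) (Real.exp (c * s) * c) s := by
          simpa using ((hasDerivAt_id s).const_mul c).exp
        exact h1.ofReal_comp.fun_mul (hu s)
      have h := norm_le_div_of_ode (a := -1) (b := 2) (by norm_num) (q₀ := 2 * c)
        (R := Real.exp (2 * c) * R) (p := fun s => s ^ 2 - 4)
        (q := fun s => c * s + c * (4 - s ^ 2))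
        (r := fun s => (Real.exp (c * s) : ℂ) * r s) (by positivity) hv
        (fun s _ => by rw [← hode s]; push_cast; ring)
        (fun s hs => by nlinarith [mul_nonneg (sub_nonneg.2 hs.1) (sub_nonneg.2 hs.2)])
        (by norm_num) (by norm_num)
        (fun s hs => by
          rw [norm_mul, Complex.norm_real, Real.norm_eq_abs, abs_of_pos (Real.exp_pos _)]
          exact mul_le_mul (Real.exp_le_exp.2 (by nlinarith [hs.2])) (hr s) (norm_nonneg _)
            (Real.exp_pos _).le) t ⟨ht, h2⟩
      rw [norm_mul, Complex.norm_real, Real.norm_eq_abs, abs_of_pos (Real.exp_pos _)] at h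
      have h3 : 1 ≤ Real.exp c * Real.exp (c * t) := by
        rw [← Real.exp_add]; exact Real.one_le_exp (by nlinarith)
      calc ‖u t‖ ≤ Real.exp c * Real.exp (c * t) * ‖u t‖ :=
            le_mul_of_one_le_left (norm_nonneg _) h3
        _ = Real.exp c * (Real.exp (c * t) * ‖u t‖) := by ring
        _ ≤ Real.exp c * (Real.exp (2 * c) * R / (2 * c)) :=
            mul_le_mul_of_nonneg_left h (Real.exp_pos _).le
        _ = _ := by
            rw [show 3 * c = c + 2 * c by ring, Real.exp_add]; ring
    · have h := norm_le_div_of_ode (a := 2) (b := t) h2 (q₀ := 2 * c) (R := R)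
        (p := fun s => s ^ 2 - 4) (q := fun s => c * s) (r := r) (by positivity) hu
        (fun s _ => by rw [← hode s]; push_cast; ring)
        (fun s hs => by nlinarith [hs.1]) (by norm_num) (by nlinarith) (fun s _ => hr s) t
        ⟨h2, le_rfl⟩
      refine h.trans ?_
      rw [div_mul_eq_mul_div]
      gcongr
      exact le_mul_of_one_le_left hR (Real.one_le_exp (by positivity))
  rcases le_total (-1) t with ht | ht
  · exact main u u' r hu hode hr t ht
  · have h := main (fun s => -u (-s)) (fun s => u' (-s)) (fun s => r (-s))
      (fun s => by simpa [Function.comp_def] using ((hu (-s)).scomp s (hasDerivAt_neg s)).fun_neg)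
      (fun s => by rw [← hode (-s)]; push_cast; ring)
      (fun s => hr (-s)) (-t) (by linarith)
    simpa using h

/-! ### Smooth functions with bounded derivatives -/

/-- `C^∞` functions all of whose derivatives, including the function itself, are bounded. -/
def SmoothBdd (g : ℝ → ℂ) : Prop :=
  ContDiff ℝ ∞ g ∧ ∀ k, ∃ B, ∀ t, ‖iteratedDeriv k g t‖ ≤ B

/-- `g` and its derivatives up to order `m` are bounded by `B`. -/
def DerivBound (m : ℕ) (B : ℝ) (g : ℝ → ℂ) : Prop :=
  ∀ i ≤ m, ∀ t, ‖iteratedDeriv i g t‖ ≤ B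

lemma SmoothBdd.exists_derivBound {g : ℝ → ℂ} (hg : SmoothBdd g) (m : ℕ) :
    ∃ B, 0 ≤ B ∧ DerivBound m B g := by
  choose B hB using hg.2
  have hB0 : ∀ i, 0 ≤ B i := fun i => (norm_nonneg _).trans (hB i 0)
  refine ⟨∑ i ∈ Finset.range (m + 1), B i, Finset.sum_nonneg fun i _ => hB0 i, ?_⟩
  intro i hi t
  exact (hB i t).trans
    (Finset.single_le_sum (fun i _ => hB0 i) (Finset.mem_range.2 (Nat.lt_succ_of_le hi)))

lemma smoothBdd_of_derivBound {g : ℝ → ℂ} (hg : ContDiff ℝ ∞ g)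
    (h : ∀ m, ∃ B, DerivBound m B g) : SmoothBdd g :=
  ⟨hg, fun k => (h k).imp fun _ hB => hB k le_rfl⟩

lemma hasDerivAt_iteratedDeriv {g : ℝ → ℂ} (hg : ContDiff ℝ ∞ g) (k : ℕ) (t : ℝ) :
    HasDerivAt (iteratedDeriv k g) (iteratedDeriv (k + 1) g t) t := by
  rw [iteratedDeriv_succ]
  exact ((hg.differentiable_iteratedDeriv k (by exact_mod_cast WithTop.coe_lt_top _)) t).hasDerivAt

lemma contDiff_iteratedDeriv {g : ℝ → ℂ} (hg : ContDiff ℝ ∞ g) (k : ℕ) :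
    ContDiff ℝ ∞ (iteratedDeriv k g) := by
  induction k with
  | zero => simpa using hg
  | succ k ih => rw [iteratedDeriv_succ]; exact (contDiff_infty_iff_deriv.1 ih).2

lemma iteratedDeriv_iteratedDeriv (i k : ℕ) (g : ℝ → ℂ) :
    iteratedDeriv i (iteratedDeriv k g) = iteratedDeriv (i + k) g := by
  simp only [iteratedDeriv_eq_iterate, Function.iterate_add_apply]

lemma SmoothBdd.iteratedDeriv {g : ℝ → ℂ} (hg : SmoothBdd g) (k : ℕ) :
    SmoothBdd (iteratedDeriv k g) :=
  ⟨contDiff_iteratedDeriv hg.1 k, fun i => by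
    rw [iteratedDeriv_iteratedDeriv]; exact hg.2 _⟩

lemma SmoothBdd.add {f g : ℝ → ℂ} (hf : SmoothBdd f) (hg : SmoothBdd g) : SmoothBdd (f + g) := by
  refine ⟨hf.1.add hg.1, fun k => ?_⟩
  obtain ⟨A, hA⟩ := hf.2 k
  obtain ⟨B, hB⟩ := hg.2 k
  refine ⟨A + B, fun t => ?_⟩
  rw [iteratedDeriv_add (hf.1.contDiffAt.of_le (by exact_mod_cast le_top))
    (hg.1.contDiffAt.of_le (by exact_mod_cast le_top))]
  exact (norm_add_le _ _).trans (add_le_add (hA t) (hB t))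

lemma SmoothBdd.const_smul {f : ℝ → ℂ} (hf : SmoothBdd f) (c : ℂ) : SmoothBdd (c • f) := by
  refine ⟨hf.1.const_smul c, fun k => ?_⟩
  obtain ⟨A, hA⟩ := hf.2 k
  refine ⟨‖c‖ * A, fun t => ?_⟩
  rw [iteratedDeriv_const_smul_field, norm_smul]
  exact mul_le_mul_of_nonneg_left (hA t) (norm_nonneg _)

lemma smoothBdd_const (c : ℂ) : SmoothBdd (fun _ => c) := by
  refine ⟨contDiff_const, fun k => ⟨‖c‖, fun t => ?_⟩⟩
  rw [iteratedDeriv_const]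
  split_ifs
  · rfl
  · simp

lemma DerivBound.add {m : ℕ} {A B : ℝ} {f g : ℝ → ℂ} (hfs : ContDiff ℝ ∞ f) (hgs : ContDiff ℝ ∞ g)
    (hf : DerivBound m A f) (hg : DerivBound m B g) : DerivBound m (A + B) (f + g) := by
  intro i hi t
  rw [iteratedDeriv_add (hfs.contDiffAt.of_le (by exact_mod_cast le_top))
    (hgs.contDiffAt.of_le (by exact_mod_cast le_top))]
  exact (norm_add_le _ _).trans (add_le_add (hf i hi t) (hg i hi t))

lemma derivBound_const (m : ℕ) (c : ℂ) : DerivBound m ‖c‖ (fun _ => c) := by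
  intro i _ t
  rw [iteratedDeriv_const]
  split_ifs
  · rfl
  · simp

lemma DerivBound.mul {m : ℕ} {A B : ℝ} {f g : ℝ → ℂ} (hfs : ContDiff ℝ ∞ f) (hgs : ContDiff ℝ ∞ g)
    (hf : DerivBound m A f) (hg : DerivBound m B g) : DerivBound m (2 ^ m * (A * B)) (f * g) := by
  have hA : 0 ≤ A := (norm_nonneg _).trans (hf 0 (Nat.zero_le _) 0)
  have hB : 0 ≤ B := (norm_nonneg _).trans (hg 0 (Nat.zero_le _) 0)
  intro i hi t
  rw [iteratedDeriv_mul (hfs.contDiffAt.of_le (by exact_mod_cast le_top))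
    (hgs.contDiffAt.of_le (by exact_mod_cast le_top))]
  calc _ ≤ ∑ k ∈ Finset.range (i + 1), (i.choose k : ℝ) * (A * B) := by
        refine (norm_sum_le _ _).trans (Finset.sum_le_sum fun k hk => ?_)
        have hk : k ≤ i := Nat.lt_succ_iff.1 (Finset.mem_range.1 hk)
        rw [norm_mul, norm_mul, Complex.norm_natCast, mul_assoc]
        gcongr
        · exact hf k (hk.trans hi) t
        · exact hg _ ((Nat.sub_le _ _).trans hi) t
    _ = 2 ^ i * (A * B) := by
        rw [← Finset.sum_mul, ← Nat.cast_sum, Nat.sum_range_choose]; push_cast; rfl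
    _ ≤ 2 ^ m * (A * B) := by
        gcongr
        norm_num

lemma SmoothBdd.mul {f g : ℝ → ℂ} (hf : SmoothBdd f) (hg : SmoothBdd g) : SmoothBdd (f * g) := by
  refine smoothBdd_of_derivBound (hf.1.mul hg.1) fun m => ?_
  obtain ⟨A, -, hA⟩ := hf.exists_derivBound m
  obtain ⟨B, -, hB⟩ := hg.exists_derivBound m
  exact ⟨_, hA.mul hf.1 hg.1 hB⟩

/-! ### A priori bounds for the equation `(t² - 4) f' + 3 t f = h` -/

/-- The first-order operator `f ↦ (t² - 4) f' + 3 t f`. -/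
noncomputable def opL (f : ℝ → ℂ) (t : ℝ) : ℂ :=
  ((t : ℂ) ^ 2 - 4) * deriv f t + 3 * (t : ℂ) * f t

/-- The equation satisfied by the `k`-th derivative of `f`. For `k = 0` the last term vanishes,
whatever `k - 1` means. -/
lemma iteratedDeriv_opL {f : ℝ → ℂ} (hf : ContDiff ℝ ∞ f) (k : ℕ) (t : ℝ) :
    iteratedDeriv k (opL f) t = ((t : ℂ) ^ 2 - 4) * iteratedDeriv (k + 1) f t +
      (2 * k + 3 : ℝ) * t * iteratedDeriv k f t +
        (k * (k + 2) : ℂ) * iteratedDeriv (k - 1) f t := by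
  have hd := hasDerivAt_iteratedDeriv hf
  induction k generalizing t with
  | zero => simp [opL]
  | succ k ih =>
    rw [iteratedDeriv_succ, funext ih]
    have h0 : HasDerivAt (fun t : ℝ => (t : ℂ)) 1 t := Complex.ofRealCLM.hasDerivAt
    have h1 : HasDerivAt (fun t : ℝ => (t : ℂ) ^ 2 - 4) (2 * (t : ℂ)) t := by
      simpa using (h0.fun_pow 2).sub_const (4 : ℂ)
    have h3 : HasDerivAt (fun t => (k * (k + 2) : ℂ) * iteratedDeriv (k - 1) f t)
        ((k * (k + 2) : ℂ) * iteratedDeriv k f t) t := by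
      cases k with
      | zero => simpa using hasDerivAt_const t (0 : ℂ)
      | succ k => exact (hd k t).const_mul _
    rw [(((h1.fun_mul (hd (k + 1) t)).fun_add
      ((h0.const_mul ((2 * k + 3 : ℝ) : ℂ)).fun_mul (hd k t))).fun_add h3).deriv]
    rw [Nat.add_sub_cancel]
    push_cast
    ring

/-- Every `C^m` norm of `f` is controlled by that of `(t² - 4) f' + 3 t f`. -/
lemma exists_derivBound_of_opL (m : ℕ) : ∃ C : ℝ, 0 ≤ C ∧ ∀ (f : ℝ → ℂ) (B : ℝ),
    ContDiff ℝ ∞ f → DerivBound m B (opL f) → DerivBound m (C * B) f := by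
  induction m with
  | zero =>
    refine ⟨Real.exp (3 * 3) / (2 * 3), by positivity, fun f B hf hB i hi t => ?_⟩
    obtain rfl : i = 0 := by omega
    rw [iteratedDeriv_zero]
    refine norm_le_of_singular_ode (u' := deriv f) (r := opL f) (by norm_num)
      (fun t => by simpa using hasDerivAt_iteratedDeriv hf 0 t)
      (fun t => by simp [opL]) (fun t => ?_) t
    simpa using hB 0 le_rfl t
  | succ m ih =>
    obtain ⟨C, hC0, hC⟩ := ih
    set M : ℝ := Real.exp (3 * (2 * (m + 1 : ℕ) + 3)) / (2 * (2 * (m + 1 : ℕ) + 3)) with hM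
    have hM0 : 0 ≤ M := by positivity
    refine ⟨C + M * (1 + (m + 1) * (m + 3) * C), by positivity, fun f B hf hB i hi t => ?_⟩
    have hB0 : 0 ≤ B := (norm_nonneg _).trans (hB 0 (Nat.zero_le _) 0)
    have hlow := hC f B hf fun i hi => hB i (hi.trans m.le_succ)
    rcases Nat.lt_or_ge m i with h | h
    · obtain rfl : i = m + 1 := by omega
      have key := norm_le_of_singular_ode (u := iteratedDeriv (m + 1) f)
        (u' := iteratedDeriv (m + 2) f) (c := 2 * (m + 1 : ℕ) + 3)
        (r := fun t => iteratedDeriv (m + 1) (opL f) t -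
          ((m + 1 : ℕ) * ((m + 1 : ℕ) + 2) : ℂ) * iteratedDeriv m f t)
        (R := B + (m + 1) * (m + 3) * (C * B)) (by positivity)
        (hasDerivAt_iteratedDeriv hf (m + 1))
        (fun t => by rw [iteratedDeriv_opL hf]; simp)
        (fun t => by
          refine (norm_sub_le _ _).trans (add_le_add (hB _ le_rfl t) ?_)
          rw [norm_mul]
          refine mul_le_mul (le_of_eq ?_) (hlow m le_rfl t) (norm_nonneg _) (by positivity)
          rw [show ((m + 1 : ℕ) * ((m + 1 : ℕ) + 2) : ℂ) = (((m + 1) * (m + 3) : ℕ) : ℂ) by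
            push_cast; ring, Complex.norm_natCast]
          push_cast
          ring) t
      refine key.trans (le_trans (le_of_eq ?_) (le_add_of_nonneg_left (mul_nonneg hC0 hB0) :
        M * (1 + (m + 1) * (m + 3) * C) * B ≤ C * B + M * (1 + (m + 1) * (m + 3) * C) * B)
        |>.trans (le_of_eq (by ring)))
      rw [hM]
      ring
    · refine (hlow i h t).trans (mul_le_mul_of_nonneg_right ?_ hB0)
      exact le_add_of_nonneg_right (by positivity)

lemma opL_sub {f g : ℝ → ℂ} (hf : ContDiff ℝ ∞ f) (hg : ContDiff ℝ ∞ g) :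
    opL (f - g) = opL f - opL g := by
  funext t
  have h1 : DifferentiableAt ℝ f t := hf.differentiable (by simp) t
  have h2 : DifferentiableAt ℝ g t := hg.differentiable (by simp) t
  simp only [opL, Pi.sub_apply, deriv_sub h1 h2]
  ring

/-- Uniqueness of smooth solutions. -/
lemma eq_of_opL_eq {f g : ℝ → ℂ} (hf : ContDiff ℝ ∞ f) (hg : ContDiff ℝ ∞ g)
    (h : opL f = opL g) : f = g := by
  obtain ⟨C, -, hC⟩ := exists_derivBound_of_opL 0
  have h0 : DerivBound 0 0 (opL (f - g)) := by
    intro i hi t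
    obtain rfl : i = 0 := by omega
    simp [opL_sub hf hg, h]
  funext t
  have := hC (f - g) 0 (hf.sub hg) h0 0 le_rfl t
  simpa [sub_eq_zero] using this

/-! ### Smooth solutions of `(t² - 4) f' + 3 t f = h` -/

/-- The average `∫_0^1 κ(s) r(2 + (t - 2) s) ds` of `r` over the segment from `2` to `t`. -/
noncomputable def segmentMean (κ : ℝ → ℂ) (r : ℝ → ℂ) (t : ℝ) : ℂ :=
  ∫ s in (0 : ℝ)..1, κ s * r (2 + (t - 2) * s)

lemma segment_mem {a b t s : ℝ} (ht : t ∈ Icc a b) (hs : s ∈ Icc (0 : ℝ) 1) :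
    2 + (t - 2) * s ∈ Icc (min a 2) (max b 2) := by
  have h1 : 2 + (t - 2) * s = (1 - s) * 2 + s * t := by ring
  have hs' : 0 ≤ 1 - s := sub_nonneg.2 hs.2
  rw [h1]
  constructor
  · calc min a 2 = (1 - s) * min a 2 + s * min a 2 := by ring
      _ ≤ _ := add_le_add (mul_le_mul_of_nonneg_left (min_le_right _ _) hs')
        (mul_le_mul_of_nonneg_left ((min_le_left _ _).trans ht.1) hs.1)
  · calc (1 - s) * 2 + s * t ≤ (1 - s) * max b 2 + s * max b 2 :=
        add_le_add (mul_le_mul_of_nonneg_left (le_max_right _ _) hs')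
          (mul_le_mul_of_nonneg_left (ht.2.trans (le_max_left _ _)) hs.1)
      _ = _ := by ring

lemma segment_mem_Ioi {t s : ℝ} (ht : -2 < t) (hs : s ∈ Icc (0 : ℝ) 1) :
    -2 < 2 + (t - 2) * s :=
  lt_of_lt_of_le (lt_min ht (by norm_num)) (segment_mem (left_mem_Icc.2 le_rfl) hs).1

lemma continuousOn_segment {r : ℝ → ℂ} (hr : ContinuousOn r (Ioi (-2))) {t : ℝ} (ht : -2 < t) :
    ContinuousOn (fun s : ℝ => r (2 + (t - 2) * s)) (Icc 0 1) :=
  hr.comp (by fun_prop) fun _ hs => segment_mem_Ioi ht hs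

lemma hasDerivAt_segmentMean {κ r : ℝ → ℂ} (hκ : Continuous κ) (hr : ContDiffOn ℝ 1 r (Ioi (-2)))
    {t : ℝ} (ht : -2 < t) :
    HasDerivAt (segmentMean κ r) (segmentMean (fun s => κ s * s) (deriv r) t) t := by
  have hr' : ContinuousOn (deriv r) (Ioi (-2)) := hr.continuousOn_deriv_of_isOpen isOpen_Ioi le_rfl
  have hmeas : ∀ (κ r : ℝ → ℂ), Continuous κ → ContinuousOn r (Ioi (-2)) → ∀ x : ℝ, -2 < x →
      ContinuousOn (fun s : ℝ => κ s * r (2 + (x - 2) * s)) (Icc 0 1) :=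
    fun κ r hκ hr x hx => hκ.continuousOn.mul (continuousOn_segment hr hx)
  have hae : ∀ f : ℝ → ℂ, ContinuousOn f (Icc 0 1) →
      AEStronglyMeasurable f (volume.restrict (uIoc 0 1)) := fun f hf => by
    rw [uIoc_of_le zero_le_one]
    exact (hf.mono Ioc_subset_Icc_self).aestronglyMeasurable measurableSet_Ioc
  set a := (t - 2) / 2 with ha
  have hat : a < t := by rw [ha]; linarith
  have ha2 : -2 < a := by rw [ha]; linarith
  have hsub : Icc (min a 2) (max (t + 1) 2) ⊆ Ioi (-2 : ℝ) := fun x hx =>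
    lt_of_lt_of_le (lt_min ha2 (by norm_num)) hx.1
  obtain ⟨M, hM⟩ := isCompact_Icc.exists_bound_of_continuousOn (hr'.mono hsub)
  obtain ⟨N, hN⟩ := isCompact_Icc.exists_bound_of_continuousOn
    (hκ.continuousOn (s := Icc (0 : ℝ) 1))
  have hIoc : ∀ s : ℝ, s ∈ uIoc (0 : ℝ) 1 → s ∈ Icc (0 : ℝ) 1 := fun s hs => by
    rw [uIoc_of_le zero_le_one] at hs
    exact Ioc_subset_Icc_self hs
  refine (intervalIntegral.hasDerivAt_integral_of_dominated_loc_of_deriv_le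
    (F := fun x s => κ s * r (2 + (x - 2) * s))
    (F' := fun x s => κ s * s * deriv r (2 + (x - 2) * s)) (bound := fun _ => N * M)
    (s := Ioo a (t + 1)) (Ioo_mem_nhds hat (by linarith)) ?_ ?_ ?_ ?_ ?_ ?_).2
  · filter_upwards [lt_mem_nhds ht] with x hx using hae _ (hmeas κ r hκ hr.continuousOn x hx)
  · exact (hmeas κ r hκ hr.continuousOn t ht).intervalIntegrable_of_Icc zero_le_one
  · exact hae _ (hmeas _ _ (hκ.mul Complex.continuous_ofReal) hr' t ht)
  · refine Eventually.of_forall fun s hs x hx => ?_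
    have hs := hIoc s hs
    have h1 := hM _ (segment_mem (Ioo_subset_Icc_self hx) hs)
    have h2 := hN s hs
    have h3 : ‖(s : ℂ)‖ ≤ 1 := by
      rw [Complex.norm_real, Real.norm_eq_abs, abs_of_nonneg hs.1]; exact hs.2
    rw [norm_mul, norm_mul]
    have h4 : ‖κ s‖ * ‖(s : ℂ)‖ ≤ N :=
      (mul_le_of_le_one_right (norm_nonneg _) h3).trans h2
    exact mul_le_mul h4 h1 (norm_nonneg _) ((norm_nonneg _).trans h2)
  · exact intervalIntegrable_const
  · refine Eventually.of_forall fun s hs x hx => ?_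
    have hs := hIoc s hs
    have hx2 : -2 < x := ha2.trans hx.1
    have h1 : HasDerivAt r (deriv r (2 + (x - 2) * s)) (2 + (x - 2) * s) :=
      ((hr.differentiableOn one_ne_zero).differentiableAt
        (isOpen_Ioi.mem_nhds (segment_mem_Ioi hx2 hs))).hasDerivAt
    have h2 : HasDerivAt (fun x : ℝ => 2 + (x - 2) * s) s x := by
      simpa using (((hasDerivAt_id x).sub_const 2).mul_const s).const_add 2
    refine ((h1.scomp x h2).const_mul (κ s)).congr_deriv ?_
    rw [Complex.real_smul]
    ring

lemma contDiffOn_segmentMean {κ r : ℝ → ℂ} (hκ : Continuous κ) (hr : ContDiffOn ℝ ∞ r (Ioi (-2))) :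
    ContDiffOn ℝ ∞ (segmentMean κ r) (Ioi (-2)) := by
  have main : ∀ n : ℕ, ∀ κ r : ℝ → ℂ, Continuous κ → ContDiffOn ℝ ∞ r (Ioi (-2)) →
      ContDiffOn ℝ n (segmentMean κ r) (Ioi (-2)) := by
    intro n
    induction n with
    | zero =>
      intro κ r hκ hr t ht
      exact (contDiffOn_zero.2 fun t ht => (hasDerivAt_segmentMean hκ
        (hr.of_le (by exact_mod_cast le_top)) ht).continuousAt.continuousWithinAt) t ht
    | succ n ih =>
      intro κ r hκ hr
      have h1 : ∀ t ∈ Ioi (-2 : ℝ), HasDerivAt (segmentMean κ r)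
          (segmentMean (fun s => κ s * s) (deriv r) t) t := fun t ht =>
        hasDerivAt_segmentMean hκ (hr.of_le (by exact_mod_cast le_top)) ht
      rw [Nat.cast_add, Nat.cast_one, contDiffOn_succ_iff_deriv_of_isOpen isOpen_Ioi]
      refine ⟨fun t ht => (h1 t ht).differentiableAt.differentiableWithinAt, by simp, ?_⟩
      exact (ih _ _ (hκ.mul Complex.continuous_ofReal)
        ((contDiffOn_infty_iff_deriv_of_isOpen isOpen_Ioi).1 hr).2).congr
        fun t ht => (h1 t ht).deriv
  exact contDiffOn_infty.2 fun n => main n κ r hκ hr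

/-- The mean with weight `√s` solves the Euler equation `(t - 2) y' + (3/2) y = r`. -/
lemma segmentMean_sqrt_ode {r : ℝ → ℂ} (hr : ContDiffOn ℝ 1 r (Ioi (-2))) {t : ℝ} (ht : -2 < t) :
    ((t : ℂ) - 2) * segmentMean (fun s => (√s : ℂ) * s) (deriv r) t +
      3 / 2 * segmentMean (fun s => (√s : ℂ)) r t = r t := by
  have hr' : ContinuousOn (deriv r) (Ioi (-2)) := hr.continuousOn_deriv_of_isOpen isOpen_Ioi le_rfl
  have hsq : Continuous fun s : ℝ => (√s : ℂ) := by fun_prop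
  have hi1 : IntervalIntegrable (fun s : ℝ => (√s : ℂ) * s * deriv r (2 + (t - 2) * s))
      volume 0 1 :=
    ContinuousOn.intervalIntegrable_of_Icc zero_le_one
      ((hsq.mul Complex.continuous_ofReal).continuousOn.mul (continuousOn_segment hr' ht))
  have hi2 : IntervalIntegrable (fun s : ℝ => (√s : ℂ) * r (2 + (t - 2) * s)) volume 0 1 :=
    ContinuousOn.intervalIntegrable_of_Icc zero_le_one
      (hsq.continuousOn.mul (continuousOn_segment hr.continuousOn ht))
  have hFTC := intervalIntegral.integral_eq_sub_of_hasDerivAt_of_le (zero_le_one' ℝ)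
    (f := fun s : ℝ => (√s : ℂ) * s * r (2 + (t - 2) * s))
    (f' := fun s : ℝ => ((t : ℂ) - 2) * ((√s : ℂ) * s * deriv r (2 + (t - 2) * s)) +
      3 / 2 * ((√s : ℂ) * r (2 + (t - 2) * s)))
    ((hsq.mul Complex.continuous_ofReal).continuousOn.mul
      (continuousOn_segment hr.continuousOn ht))
    (fun s hs => by
      have hs0 : (√s : ℂ) ≠ 0 := by exact_mod_cast (Real.sqrt_pos.2 hs.1).ne'
      have h1 : HasDerivAt r (deriv r (2 + (t - 2) * s)) (2 + (t - 2) * s) :=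
        ((hr.differentiableOn one_ne_zero).differentiableAt
          (isOpen_Ioi.mem_nhds (segment_mem_Ioi ht (Ioo_subset_Icc_self hs)))).hasDerivAt
      have h2 : HasDerivAt (fun s : ℝ => 2 + (t - 2) * s) (t - 2) s := by
        simpa using ((hasDerivAt_id s).const_mul (t - 2)).const_add 2
      have h3 : HasDerivAt (fun s : ℝ => (√s : ℂ)) ((1 / (2 * √s) : ℝ) : ℂ) s :=
        (Real.hasDerivAt_sqrt hs.1.ne').ofReal_comp
      have h4 : HasDerivAt (fun s : ℝ => (s : ℂ)) 1 s := Complex.ofRealCLM.hasDerivAt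
      have h5 : (s : ℂ) = (√s : ℂ) ^ 2 := by exact_mod_cast (Real.sq_sqrt hs.1.le).symm
      refine ((h3.fun_mul h4).fun_mul (h1.scomp s h2)).congr_deriv ?_
      rw [Complex.real_smul]
      simp only [Function.comp_apply]
      generalize deriv r (2 + (t - 2) * s) = A
      generalize r (2 + (t - 2) * s) = B
      push_cast
      rw [h5]
      field_simp
      ring)
    ((hi1.const_mul _).add (hi2.const_mul _))
  rw [intervalIntegral.integral_add (hi1.const_mul _) (hi2.const_mul _),
    intervalIntegral.integral_const_mul, intervalIntegral.integral_const_mul] at hFTC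
  simpa [segmentMean] using hFTC

/-- The equation has a solution which is smooth across the singular point `2`: with
`f = (t + 2)^{-3/2} y` it becomes an Euler equation for `y`. -/
lemma exists_opL_eq_right {h : ℝ → ℂ} (hh : ContDiff ℝ ∞ h) :
    ∃ f : ℝ → ℂ, ContDiffOn ℝ ∞ f (Ioi (-2)) ∧ ∀ t, -2 < t → opL f t = h t := by
  set q : ℝ → ℂ := fun t => (√(t + 2) : ℂ) with hq
  have hqs : ContDiffOn ℝ ∞ q (Ioi (-2)) := by
    intro t ht
    have h1 : ContDiffAt ℝ ∞ (fun t : ℝ => √(t + 2)) t :=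
      (contDiffAt_id.add contDiffAt_const).sqrt (by have : -2 < t := ht; simp; linarith)
    exact (Complex.ofRealCLM.contDiff.contDiffAt.comp t h1).contDiffWithinAt
  have hq0 : ∀ t ∈ Ioi (-2 : ℝ), q t ≠ 0 := fun t ht => by
    have : -2 < t := ht
    simp only [hq]
    exact_mod_cast (Real.sqrt_pos.2 (by linarith : 0 < t + 2)).ne'
  set r : ℝ → ℂ := fun t => q t * h t with hr
  have hrs : ContDiffOn ℝ ∞ r (Ioi (-2)) := hqs.mul hh.contDiffOn
  have hr1 : ContDiffOn ℝ 1 r (Ioi (-2)) := hrs.of_le (by exact_mod_cast le_top)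
  have hsq : Continuous fun s : ℝ => (√s : ℂ) := by fun_prop
  refine ⟨fun t => segmentMean (fun s => (√s : ℂ)) r t * ((q t) ^ 3)⁻¹,
    (contDiffOn_segmentMean hsq hrs).mul ((hqs.pow 3).inv fun t ht => pow_ne_zero 3 (hq0 t ht)),
    fun t ht => ?_⟩
  have hy := hasDerivAt_segmentMean hsq hr1 ht
  have hode := segmentMean_sqrt_ode hr1 ht
  have hqt := hq0 t ht
  have hq2 : (t : ℂ) = q t ^ 2 - 2 := by
    have h1 : √(t + 2) ^ 2 = t + 2 := Real.sq_sqrt (by linarith)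
    have h2 : ((√(t + 2) ^ 2 : ℝ) : ℂ) = ((t + 2 : ℝ) : ℂ) := by rw [h1]
    push_cast at h2
    simp only [hq, h2]
    ring
  have hq' : HasDerivAt q (1 / (2 * q t)) t := by
    have h1 : HasDerivAt (fun t : ℝ => √(t + 2)) (1 / (2 * √(t + 2))) t := by
      have h3 : HasDerivAt (fun t : ℝ => t + 2) 1 t := (hasDerivAt_id t).add_const 2
      simpa using h3.sqrt (by linarith)
    simpa [hq] using h1.ofReal_comp
  have hinv : HasDerivAt (fun t => ((q t) ^ 3)⁻¹) (-(3 * q t ^ 2 * (1 / (2 * q t))) / (q t ^ 3) ^ 2)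
      t := by
    simpa using (hq'.fun_pow 3).fun_inv (pow_ne_zero 3 hqt)
  rw [opL, (hy.fun_mul hinv).deriv]
  simp only [hr] at hode
  generalize segmentMean (fun s => (√s : ℂ)) r t = Y at *
  generalize segmentMean (fun s => (√s : ℂ) * s) (deriv r) t = Y' at *
  generalize q t = Q at *
  rw [hq2] at hode ⊢
  have : h t = Q⁻¹ * (Q * h t) := by field_simp
  rw [this, ← hode]
  field_simp
  ring

lemma opL_congr {f g : ℝ → ℂ} {t : ℝ} (h : f =ᶠ[𝓝 t] g) : opL f t = opL g t := by
  rw [opL, opL, h.deriv_eq, h.eq_of_nhds]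

/-- The equation has a solution which is smooth across the singular point `-2`. -/
lemma exists_opL_eq_left {h : ℝ → ℂ} (hh : ContDiff ℝ ∞ h) :
    ∃ f : ℝ → ℂ, ContDiffOn ℝ ∞ f (Iio 2) ∧ ∀ t, t < 2 → opL f t = h t := by
  obtain ⟨f, hf, hfh⟩ := exists_opL_eq_right (hh.comp contDiff_neg)
  refine ⟨fun t => -f (-t), ?_, fun t ht => ?_⟩
  · exact (hf.comp contDiff_neg.contDiffOn fun t ht => by
      have : t < 2 := ht
      simp; linarith).neg
  · have hd : HasDerivAt f (deriv f (-t)) (-t) :=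
      ((hf.differentiableOn (by simp)).differentiableAt
        (isOpen_Ioi.mem_nhds (by simp; linarith))).hasDerivAt
    have hd' : HasDerivAt (fun t => -f (-t)) (deriv f (-t)) t := by
      simpa [Function.comp_def] using (hd.scomp t (hasDerivAt_neg t)).fun_neg
    have := hfh (-t) (by linarith)
    simp only [opL, Function.comp_apply, neg_neg] at this
    rw [opL, hd'.deriv, ← this]
    push_cast
    ring

/-! ### The semicircle law -/

/-- The weight `(4 - t²)^{3/2}`: multiplication by it turns the equation into a total derivative. -/
noncomputable def weight (t : ℝ) : ℂ := ((4 - t ^ 2) * √(4 - t ^ 2) : ℝ)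

lemma integral_semicircle_opL {a b : ℝ} (ha : -2 ≤ a) (hab : a ≤ b) (hb : b ≤ 2) {f h : ℝ → ℂ}
    (hf : ContinuousOn f (Icc a b)) (hf' : ∀ t ∈ Ioo a b, DifferentiableAt ℝ f t)
    (hh : ContinuousOn h (Icc a b)) (hode : ∀ t ∈ Ioo a b, opL f t = h t) :
    ∫ t in a..b, h t * (√(4 - t ^ 2) : ℂ) = weight a * f a - weight b * f b := by
  have hw : Continuous weight := by unfold weight; fun_prop
  have hs : Continuous fun t : ℝ => (√(4 - t ^ 2) : ℂ) := by fun_prop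
  have h := intervalIntegral.integral_eq_sub_of_hasDerivAt_of_le hab
    (f := fun t => weight t * f t) (f' := fun t => -(h t * (√(4 - t ^ 2) : ℂ)))
    (hw.continuousOn.mul hf)
    (fun t ht => by
      have hpos : 0 < 4 - t ^ 2 := by nlinarith [ht.1, ht.2]
      have hs0 : (√(4 - t ^ 2) : ℂ) ≠ 0 := by exact_mod_cast (Real.sqrt_pos.2 hpos).ne'
      have h1 : HasDerivAt (fun t : ℝ => 4 - t ^ 2) (-(2 * t)) t := by
        simpa using (hasDerivAt_pow 2 t).const_sub 4
      have h2 := (h1.fun_mul (h1.sqrt hpos.ne')).ofReal_comp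
      have h5 : (t : ℂ) ^ 2 = 4 - (√(4 - t ^ 2) : ℂ) ^ 2 := by
        have : (√(4 - t ^ 2)) ^ 2 = 4 - t ^ 2 := Real.sq_sqrt hpos.le
        rw [← Complex.ofReal_pow (√(4 - t ^ 2)), this]
        push_cast
        ring
      refine (h2.fun_mul (hf' t ht).hasDerivAt).congr_deriv ?_
      rw [← hode t ht, opL]
      push_cast
      rw [h5]
      generalize (√(4 - t ^ 2) : ℂ) = Q at *
      field_simp
      ring)
    (ContinuousOn.intervalIntegrable_of_Icc hab (hh.mul hs.continuousOn).neg)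
  rw [intervalIntegral.integral_neg] at h
  linear_combination -h

lemma weight_two : weight 2 = 0 := by norm_num [weight]

lemma weight_neg_two : weight (-2) = 0 := by norm_num [weight]

lemma semicircleMean_opL {f : ℝ → ℂ} (hf : ContDiff ℝ ∞ f) : semicircleMean (opL f) = 0 := by
  have hc : Continuous (opL f) := by
    have h1 := (contDiff_infty_iff_deriv.1 hf).2.continuous
    have h2 := hf.continuous
    unfold opL
    fun_prop
  rw [semicircleMean, integral_semicircle_opL le_rfl (by norm_num) le_rfl hf.continuous.continuousOn
    (fun t _ => hf.differentiable (by simp) t) hc.continuousOn (fun _ _ => rfl), weight_two,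
    weight_neg_two]
  simp

lemma integral_sqrt_four_sub_sq : ∫ s in (-2 : ℝ)..2, √(4 - s ^ 2) = 2 * Real.pi := by
  have h1 : ∀ s : ℝ, √(4 - s ^ 2) = 2 * √(1 - (s / 2) ^ 2) := by
    intro s
    rw [show 4 - s ^ 2 = 2 ^ 2 * (1 - (s / 2) ^ 2) by ring, Real.sqrt_mul (by norm_num),
      Real.sqrt_sq (by norm_num)]
  simp only [h1]
  rw [intervalIntegral.integral_const_mul,
    intervalIntegral.integral_comp_div (fun x => √(1 - x ^ 2)) two_ne_zero]
  norm_num [integral_sqrt_one_sub_sq]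
  ring

lemma semicircleMean_add {f g : ℝ → ℂ} (hf : Continuous f) (hg : Continuous g) :
    semicircleMean (f + g) = semicircleMean f + semicircleMean g := by
  have hs : Continuous fun t : ℝ => (√(4 - t ^ 2) : ℂ) := by fun_prop
  have h := intervalIntegral.integral_add ((hf.mul hs).intervalIntegrable (μ := volume) (-2) 2)
    ((hg.mul hs).intervalIntegrable (-2) 2)
  simp only [Pi.mul_apply] at h
  simp only [semicircleMean, Pi.add_apply, add_mul]
  rw [h, mul_add]

lemma semicircleMean_const_smul (c : ℂ) (f : ℝ → ℂ) :
    semicircleMean (c • f) = c * semicircleMean f := by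
  simp only [semicircleMean, Pi.smul_apply, smul_eq_mul, mul_assoc]
  rw [intervalIntegral.integral_const_mul]
  ring

lemma semicircleMean_const (c : ℂ) : semicircleMean (fun _ => c) = c := by
  have hpi : (Real.pi : ℂ) ≠ 0 := by exact_mod_cast Real.pi_ne_zero
  rw [semicircleMean, intervalIntegral.integral_const_mul, intervalIntegral.integral_ofReal,
    integral_sqrt_four_sub_sq]
  push_cast
  field_simp

lemma norm_semicircleMean_le {g : ℝ → ℂ} {B : ℝ} (hg : ∀ t, ‖g t‖ ≤ B) :
    ‖semicircleMean g‖ ≤ B := by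
  have hi : IntervalIntegrable (fun s : ℝ => B * √(4 - s ^ 2)) volume (-2) 2 :=
    Continuous.intervalIntegrable (by fun_prop) _ _
  have h := intervalIntegral.norm_integral_le_of_norm_le (a := (-2 : ℝ)) (b := 2) (by norm_num)
    (f := fun s => g s * (√(4 - s ^ 2) : ℂ)) (g := fun s => B * √(4 - s ^ 2)) (μ := volume)
    (Eventually.of_forall fun s _ => by
      rw [norm_mul, Complex.norm_real, Real.norm_eq_abs, abs_of_nonneg (Real.sqrt_nonneg _)]
      exact mul_le_mul_of_nonneg_right (hg s) (Real.sqrt_nonneg _)) hi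
  rw [intervalIntegral.integral_const_mul, integral_sqrt_four_sub_sq] at h
  have hn : ‖1 / (2 * (Real.pi : ℂ))‖ = 1 / (2 * Real.pi) := by
    simp [abs_of_pos Real.pi_pos]
  rw [semicircleMean, norm_mul, hn]
  calc _ ≤ 1 / (2 * Real.pi) * (B * (2 * Real.pi)) :=
        mul_le_mul_of_nonneg_left h (by positivity)
    _ = B := by field_simp

/-! ### The operators `S` and `T` -/

/-- The solutions which are smooth near `2` and near `-2` agree on `(-2, 2)` because the right-hand
side has semicircular mean zero. -/
lemma exists_solvesAux {g : ℝ → ℂ} (hg : ContDiff ℝ ∞ g) : ∃ f, SolvesAux g f := by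
  set m := semicircleMean g with hm
  set h : ℝ → ℂ := fun t => g t - m with hh
  have hhs : ContDiff ℝ ∞ h := hg.sub contDiff_const
  have hmean : semicircleMean h = 0 := by
    have : h = g + fun _ => -m := by funext t; simp [hh, sub_eq_add_neg]
    rw [this, semicircleMean_add hg.continuous continuous_const, semicircleMean_const, ← hm]
    ring
  obtain ⟨f₁, hf₁, hode₁⟩ := exists_opL_eq_right hhs
  obtain ⟨f₂, hf₂, hode₂⟩ := exists_opL_eq_left hhs
  have heq : ∀ t ∈ Ioo (-2 : ℝ) 2, f₁ t = f₂ t := by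
    intro t ht
    have h1 := integral_semicircle_opL ht.1.le ht.2.le le_rfl (f := f₁) (h := h)
      (hf₁.continuousOn.mono fun x hx => lt_of_lt_of_le ht.1 hx.1)
      (fun x hx => (hf₁.differentiableOn (by simp)).differentiableAt
        (isOpen_Ioi.mem_nhds (ht.1.trans hx.1)))
      hhs.continuous.continuousOn (fun x hx => hode₁ x (ht.1.trans hx.1))
    have h2 := integral_semicircle_opL le_rfl ht.1.le ht.2.le (f := f₂) (h := h)
      (hf₂.continuousOn.mono fun x hx => lt_of_le_of_lt hx.2 ht.2)
      (fun x hx => (hf₂.differentiableOn (by simp)).differentiableAt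
        (isOpen_Iio.mem_nhds (hx.2.trans ht.2)))
      hhs.continuous.continuousOn (fun x hx => hode₂ x (hx.2.trans ht.2))
    have hs : Continuous fun t : ℝ => h t * (√(4 - t ^ 2) : ℂ) := by
      have := hhs.continuous
      fun_prop
    have h3 := intervalIntegral.integral_add_adjacent_intervals
      (hs.intervalIntegrable (-2) t) (hs.intervalIntegrable t 2) (μ := volume)
    have h4 : ∫ t in (-2 : ℝ)..2, h t * (√(4 - t ^ 2) : ℂ) = 0 := by
      have hpi : (Real.pi : ℂ) ≠ 0 := by exact_mod_cast Real.pi_ne_zero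
      rw [semicircleMean] at hmean
      exact (mul_eq_zero.1 hmean).resolve_left (by simp [hpi])
    rw [h1, h2, h4, weight_two, weight_neg_two] at h3
    have hw : weight t ≠ 0 := by
      have hpos : 0 < 4 - t ^ 2 := by nlinarith [ht.1, ht.2]
      rw [weight]
      exact_mod_cast (mul_pos hpos (Real.sqrt_pos.2 hpos)).ne'
    have h5 : weight t * (f₁ t - f₂ t) = 0 := by linear_combination h3
    exact sub_eq_zero.1 ((mul_eq_zero.1 h5).resolve_left hw)
  set f : ℝ → ℂ := fun t => if -2 < t then f₁ t else f₂ t with hf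
  have hr : ∀ t ∈ Ioi (-2 : ℝ), f t = f₁ t := fun t ht => if_pos ht
  have hl : ∀ t ∈ Iio (2 : ℝ), f t = f₂ t := by
    intro t ht
    by_cases h1 : -2 < t
    · rw [hr t h1, heq t ⟨h1, ht⟩]
    · simp [hf, h1]
  have hloc : ∀ t, (-2 < t ∧ f =ᶠ[𝓝 t] f₁) ∨ (t < 2 ∧ f =ᶠ[𝓝 t] f₂) := by
    intro t
    rcases lt_or_ge (-2) t with h1 | h1
    · exact Or.inl ⟨h1, eventually_of_mem (isOpen_Ioi.mem_nhds h1) hr⟩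
    · have h2 : t < 2 := by linarith
      exact Or.inr ⟨h2, eventually_of_mem (isOpen_Iio.mem_nhds h2) hl⟩
  refine ⟨f, contDiff_iff_contDiffAt.2 fun t => ?_, fun t => ?_⟩
  · rcases hloc t with ⟨ht, h⟩ | ⟨ht, h⟩
    · exact ((hf₁ t ht).contDiffAt (isOpen_Ioi.mem_nhds ht)).congr_of_eventuallyEq h
    · exact ((hf₂ t ht).contDiffAt (isOpen_Iio.mem_nhds ht)).congr_of_eventuallyEq h
  · have key : opL f t = h t := by
      rcases hloc t with ⟨ht, h⟩ | ⟨ht, h⟩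
      · rw [opL_congr h, hode₁ t ht]
      · rw [opL_congr h, hode₂ t ht]
    simp only [opL, hh] at key
    rw [add_assoc, key]
    ring

lemma solvesAux_iff {g f : ℝ → ℂ} :
    SolvesAux g f ↔ ContDiff ℝ ∞ f ∧ g = (fun _ => semicircleMean g) + opL f := by
  simp only [SolvesAux, funext_iff, Pi.add_apply, opL, add_assoc]

lemma SolvesAux.unique {g f₁ f₂ : ℝ → ℂ} (h₁ : SolvesAux g f₁) (h₂ : SolvesAux g f₂) :
    f₁ = f₂ := by
  rw [solvesAux_iff] at h₁ h₂
  exact eq_of_opL_eq h₁.1 h₂.1 (add_left_cancel (h₁.2.symm.trans h₂.2))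

lemma opS_eq {g f : ℝ → ℂ} (h : SolvesAux g f) : opS g = f := by
  have hex : ∃ f, SolvesAux g f := ⟨f, h⟩
  rw [opS, dif_pos hex]
  exact hex.choose_spec.unique h

lemma solvesAux_opS {g : ℝ → ℂ} (hg : ContDiff ℝ ∞ g) : SolvesAux g (opS g) := by
  obtain ⟨f, hf⟩ := exists_solvesAux hg
  rwa [opS_eq hf]

lemma exists_derivBound_opS (m : ℕ) : ∃ C : ℝ, 0 ≤ C ∧ ∀ (g : ℝ → ℂ) (B : ℝ),
    ContDiff ℝ ∞ g → DerivBound m B g → DerivBound m (C * B) (opS g) := by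
  obtain ⟨C, hC0, hC⟩ := exists_derivBound_of_opL m
  refine ⟨C * 2, by positivity, fun g B hg hB => ?_⟩
  obtain ⟨hs, heq⟩ := solvesAux_iff.1 (solvesAux_opS hg)
  rw [mul_assoc]
  refine hC _ _ hs ?_
  have h1 : opL (opS g) = g + fun _ => -semicircleMean g := by
    funext t
    have := congrFun heq t
    simp only [Pi.add_apply] at this ⊢
    linear_combination -this
  have h2 : ‖-semicircleMean g‖ ≤ B := by
    rw [norm_neg]
    exact norm_semicircleMean_le fun t => by simpa using hB 0 (Nat.zero_le _) t
  rw [h1, two_mul]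
  exact hB.add hg contDiff_const fun i hi t => (derivBound_const m _ i hi t).trans h2

lemma exists_derivBound_opT (m : ℕ) : ∃ C : ℝ, 0 ≤ C ∧ ∀ (g : ℝ → ℂ) (B : ℝ),
    ContDiff ℝ ∞ g → DerivBound (m + 3) B g → DerivBound m (C * B) (opT g) := by
  obtain ⟨C, hC0, hC⟩ := exists_derivBound_opS (m + 3)
  refine ⟨C, hC0, fun g B hg hB i hi t => ?_⟩
  rw [opT, iteratedDeriv_iteratedDeriv]
  exact hC g B hg hB (i + 3) (by omega) t

lemma SmoothBdd.opS {g : ℝ → ℂ} (hg : SmoothBdd g) : SmoothBdd (opS g) := by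
  refine smoothBdd_of_derivBound (solvesAux_opS hg.1).1 fun m => ?_
  obtain ⟨C, -, hC⟩ := exists_derivBound_opS m
  obtain ⟨B, -, hB⟩ := hg.exists_derivBound m
  exact ⟨_, hC g B hg.1 hB⟩

lemma SmoothBdd.opT {g : ℝ → ℂ} (hg : SmoothBdd g) : SmoothBdd (opT g) :=
  hg.opS.iteratedDeriv 3

lemma SmoothBdd.opT_iterate {g : ℝ → ℂ} (hg : SmoothBdd g) (j : ℕ) :
    SmoothBdd (GUEExpansion.opT^[j] g) := by
  induction j with
  | zero => exact hg
  | succ j ih => rw [Function.iterate_succ_apply']; exact ih.opT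

lemma opS_add {f g : ℝ → ℂ} (hf : ContDiff ℝ ∞ f) (hg : ContDiff ℝ ∞ g) :
    opS (f + g) = opS f + opS g := by
  obtain ⟨h1, e1⟩ := solvesAux_opS hf
  obtain ⟨h2, e2⟩ := solvesAux_opS hg
  refine opS_eq ⟨h1.add h2, fun t => ?_⟩
  rw [semicircleMean_add hf.continuous hg.continuous,
    deriv_add (h1.differentiable (by simp) t) (h2.differentiable (by simp) t), Pi.add_apply,
    Pi.add_apply, e1 t, e2 t]
  ring

lemma opS_const_smul {f : ℝ → ℂ} (hf : ContDiff ℝ ∞ f) (c : ℂ) : opS (c • f) = c • opS f := by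
  obtain ⟨h1, e1⟩ := solvesAux_opS hf
  refine opS_eq ⟨h1.const_smul c, fun t => ?_⟩
  rw [semicircleMean_const_smul, deriv_const_smul _ (h1.differentiable (by simp) t),
    Pi.smul_apply, Pi.smul_apply, e1 t]
  simp only [smul_eq_mul]
  ring

lemma opT_add {f g : ℝ → ℂ} (hf : ContDiff ℝ ∞ f) (hg : ContDiff ℝ ∞ g) :
    opT (f + g) = opT f + opT g := by
  funext t
  rw [opT, opS_add hf hg, iteratedDeriv_add, Pi.add_apply, opT, opT]
  · exact (contDiff_infty.1 (solvesAux_opS hf).1 3).contDiffAt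
  · exact (contDiff_infty.1 (solvesAux_opS hg).1 3).contDiffAt

lemma opT_const_smul {f : ℝ → ℂ} (hf : ContDiff ℝ ∞ f) (c : ℂ) : opT (c • f) = c • opT f := by
  funext t
  rw [opT, opS_const_smul hf, Pi.smul_apply, iteratedDeriv_const_smul_field, opT]

lemma opT_opL {f : ℝ → ℂ} (hf : ContDiff ℝ ∞ f) : opT (opL f) = iteratedDeriv 3 f := by
  rw [opT, opS_eq (f := f)]
  rw [solvesAux_iff, semicircleMean_opL hf]
  exact ⟨hf, by funext t; simp⟩

lemma opT_const (c : ℂ) : opT (fun _ => c) = 0 := by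
  have h : SolvesAux (fun _ => c) (fun _ => 0) :=
    ⟨contDiff_const, fun t => by simp [semicircleMean_const]⟩
  funext t
  rw [opT, opS_eq h]
  simp

/-! ### The expansion of `∫ g h_n` in powers of `n⁻²` -/

/-- The integral of `g` against `p(t) exp(-b t²) dt`. -/
noncomputable def gaussPairing (b : ℝ) (p : Polynomial ℝ) (g : ℝ → ℂ) : ℂ :=
  ∫ t : ℝ, g t * ((p.eval t * Real.exp (-b * t ^ 2) : ℝ) : ℂ)

lemma integrable_gaussPairing {b : ℝ} (hb : 0 < b) (p : Polynomial ℝ) {g : ℝ → ℂ}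
    (hg : SmoothBdd g) :
    Integrable fun t : ℝ => g t * ((p.eval t * Real.exp (-b * t ^ 2) : ℝ) : ℂ) := by
  obtain ⟨B, hB⟩ := hg.2 0
  exact (integrable_eval_mul_gauss hb p).ofReal.bdd_mul
    hg.1.continuous.aestronglyMeasurable (Eventually.of_forall fun t => by simpa using hB t)

lemma gaussPairing_add {b : ℝ} (hb : 0 < b) (p q : Polynomial ℝ) {g : ℝ → ℂ} (hg : SmoothBdd g) :
    gaussPairing b (p + q) g = gaussPairing b p g + gaussPairing b q g := by
  rw [gaussPairing, gaussPairing, gaussPairing,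
    ← integral_add (integrable_gaussPairing hb p hg) (integrable_gaussPairing hb q hg)]
  congr 1 with t
  rw [Polynomial.eval_add]
  push_cast
  ring

lemma gaussPairing_C_mul (b c : ℝ) (p : Polynomial ℝ) (g : ℝ → ℂ) :
    gaussPairing b (Polynomial.C c * p) g = c * gaussPairing b p g := by
  rw [gaussPairing, gaussPairing, ← integral_const_mul]
  congr 1 with t
  rw [Polynomial.eval_mul, Polynomial.eval_C]
  push_cast
  ring

lemma gaussPairing_deriv {b : ℝ} (hb : 0 < b) (p : Polynomial ℝ) {g : ℝ → ℂ} (hg : SmoothBdd g) :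
    gaussPairing b p (deriv g) = -gaussPairing b (gaussDeriv b p) g := by
  have hg' : SmoothBdd (deriv g) := by simpa using hg.iteratedDeriv 1
  have h := integral_mul_deriv_eq_deriv_mul_of_integrable (u := g) (u' := deriv g)
    (v := fun t : ℝ => ((p.eval t * Real.exp (-b * t ^ 2) : ℝ) : ℂ))
    (v' := fun t : ℝ => (((gaussDeriv b p).eval t * Real.exp (-b * t ^ 2) : ℝ) : ℂ))
    (fun t _ => (hg.1.differentiable (by simp) t).hasDerivAt)
    (fun t _ => (hasDerivAt_eval_mul_gauss b p t).ofReal_comp)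
    (integrable_gaussPairing hb _ hg) (integrable_gaussPairing hb _ hg')
    (integrable_gaussPairing hb _ hg)
  rw [gaussPairing, gaussPairing, h, neg_neg]

/-- The integral of `g` against the mean spectral distribution of a `GUE(n, 1/n)` matrix. -/
noncomputable def gueMean (n : ℕ) (g : ℝ → ℂ) : ℂ := ∫ t : ℝ, g t * (gueDensity n t : ℂ)

lemma gueMean_eq_gaussPairing (n : ℕ) (g : ℝ → ℂ) :
    gueMean n g = gaussPairing (n / 2) (guePoly n) g := by
  simp only [gueMean, gaussPairing, gueDensity_eq]

/-- The differential equation of the density in weak form, after integration by parts. -/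
lemma gueMean_opL {n : ℕ} (hn : 1 ≤ n) {f : ℝ → ℂ} (hf : SmoothBdd f) :
    gueMean n (opL f) = ((n : ℂ) ^ 2)⁻¹ * gueMean n (iteratedDeriv 3 f) := by
  have hb : (0 : ℝ) < (n : ℝ) / 2 := by
    have : (0 : ℝ) < n := by exact_mod_cast hn
    positivity
  have hf1 : SmoothBdd (deriv f) := by simpa using hf.iteratedDeriv 1
  have hf2 : SmoothBdd (deriv (deriv f)) := by simpa using hf1.iteratedDeriv 1
  have h3 : iteratedDeriv 3 f = deriv (deriv (deriv f)) := by simp [iteratedDeriv_succ]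
  simp only [gueMean_eq_gaussPairing]
  set b : ℝ := (n : ℝ) / 2
  set p := guePoly n with hp
  have hL : gaussPairing b p (opL f) =
      gaussPairing b ((Polynomial.X ^ 2 - 4) * p) (deriv f) +
        gaussPairing b (Polynomial.C 3 * (Polynomial.X * p)) f := by
    rw [gaussPairing, gaussPairing, gaussPairing, ← integral_add
      (integrable_gaussPairing hb _ hf1) (integrable_gaussPairing hb _ hf)]
    congr 1 with t
    simp only [opL, Polynomial.eval_mul, Polynomial.eval_sub, Polynomial.eval_pow,
      Polynomial.eval_X, Polynomial.eval_C, Polynomial.eval_ofNat]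
    push_cast
    ring
  have hpoly : Polynomial.C (-1) * gaussDeriv b ((Polynomial.X ^ 2 - 4) * p) +
      Polynomial.C 3 * (Polynomial.X * p) =
        Polynomial.C (-((n : ℝ) ^ 2)⁻¹) * gaussDeriv b (gaussDeriv b (gaussDeriv b p)) := by
    have hode := guePoly_ode hn
    have hprod : gaussDeriv b ((Polynomial.X ^ 2 - 4) * p) =
        2 * Polynomial.X * p + (Polynomial.X ^ 2 - 4) * gaussDeriv b p := by
      simp only [gaussDeriv, Polynomial.derivative_mul, Polynomial.derivative_sub, pow_two,
        Polynomial.derivative_X, Polynomial.derivative_ofNat]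
      ring
    have hC3 : (Polynomial.C 3 : Polynomial ℝ) = 3 := rfl
    rw [hprod, hC3, map_neg, map_neg, map_one]
    linear_combination hode
  rw [hL, gaussPairing_deriv hb _ hf, h3, gaussPairing_deriv hb _ hf2,
    gaussPairing_deriv hb _ hf1, gaussPairing_deriv hb _ hf]
  have h := congrArg (fun q => gaussPairing b q f) hpoly
  simp only [gaussPairing_add hb _ _ hf, gaussPairing_C_mul] at h
  rw [gaussPairing_C_mul]
  push_cast at h ⊢
  linear_combination h

lemma gueMean_const {n : ℕ} (hn : 1 ≤ n) (c : ℂ) : gueMean n (fun _ => c) = c := by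
  rw [gueMean, integral_const_mul, integral_complex_ofReal, integral_gueDensity hn]
  simp

lemma norm_gueMean_le {n : ℕ} (hn : 1 ≤ n) {g : ℝ → ℂ} {B : ℝ} (hg : ∀ t, ‖g t‖ ≤ B) :
    ‖gueMean n g‖ ≤ B := by
  have h := norm_integral_le_of_norm_le ((integrable_gueDensity hn).const_mul B)
    (f := fun t => g t * (gueDensity n t : ℂ)) (Eventually.of_forall fun t => by
      rw [norm_mul, Complex.norm_real, Real.norm_eq_abs, abs_of_nonneg (gueDensity_nonneg n t)]
      exact mul_le_mul_of_nonneg_right (hg t) (gueDensity_nonneg n t))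
  rwa [integral_const_mul, integral_gueDensity hn, mul_one] at h

lemma gueMean_add {n : ℕ} (hn : 1 ≤ n) {f g : ℝ → ℂ} {A B : ℝ} (hf : Continuous f)
    (hg : Continuous g) (hfA : ∀ t, ‖f t‖ ≤ A) (hgB : ∀ t, ‖g t‖ ≤ B) :
    gueMean n (f + g) = gueMean n f + gueMean n g := by
  have hi : ∀ {f : ℝ → ℂ} {A : ℝ}, Continuous f → (∀ t, ‖f t‖ ≤ A) →
      Integrable fun t => f t * (gueDensity n t : ℂ) := fun hf hA =>
    (integrable_gueDensity hn).ofReal.bdd_mul hf.aestronglyMeasurable (Eventually.of_forall hA)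
  rw [gueMean, gueMean, gueMean, ← integral_add (hi hf hfA) (hi hg hgB)]
  simp only [Pi.add_apply, add_mul]

/-- One step of the expansion. -/
lemma gueMean_eq_add_opT {n : ℕ} (hn : 1 ≤ n) {g : ℝ → ℂ} (hg : SmoothBdd g) :
    gueMean n g = semicircleMean g + ((n : ℂ) ^ 2)⁻¹ * gueMean n (opT g) := by
  obtain ⟨hs, heq⟩ := solvesAux_iff.1 (solvesAux_opS hg.1)
  have h1 : opL (opS g) = g + fun _ => -semicircleMean g := by
    funext t
    have := congrFun heq t
    simp only [Pi.add_apply] at this ⊢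
    linear_combination -this
  obtain ⟨B, hB⟩ := hg.2 0
  have h2 := gueMean_opL hn hg.opS
  rw [h1, gueMean_add hn hg.1.continuous continuous_const (fun t => by simpa using hB t)
    (fun t => le_rfl), gueMean_const hn] at h2
  rw [opT, ← h2]
  ring

lemma gueMean_expansion {n : ℕ} (hn : 1 ≤ n) {g : ℝ → ℂ} (hg : SmoothBdd g) (k : ℕ) :
    gueMean n g = ∑ j ∈ Finset.range k, semicircleMean (opT^[j] g) / (n : ℂ) ^ (2 * j) +
      gueMean n (opT^[k] g) / (n : ℂ) ^ (2 * k) := by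
  induction k with
  | zero => simp
  | succ k ih =>
    have hn0 : (n : ℂ) ≠ 0 := by exact_mod_cast (by omega : n ≠ 0)
    rw [ih, Finset.sum_range_succ, gueMean_eq_add_opT hn (hg.opT_iterate k),
      Function.iterate_succ_apply']
    field_simp
    ring

/-! ### Resolvent functions -/

lemma sub_ofReal_ne_zero {z : ℂ} (hz : z.im ≠ 0) (t : ℝ) : z - (t : ℂ) ≠ 0 := fun h => by
  have := congrArg Complex.im h
  simp at this
  exact hz this

lemma abs_im_le_norm_sub_ofReal (z : ℂ) (t : ℝ) : |z.im| ≤ ‖z - (t : ℂ)‖ := by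
  simpa using Complex.abs_im_le_norm (z - (t : ℂ))

lemma iteratedDeriv_resolventFun {z : ℂ} (hz : z.im ≠ 0) (k : ℕ) :
    iteratedDeriv k (resolventFun z) = fun t => (k.factorial : ℂ) * resolventFun z t ^ (k + 1) := by
  induction k with
  | zero => funext t; simp
  | succ k ih =>
    funext t
    have h0 : HasDerivAt (fun t : ℝ => z - (t : ℂ)) (-1) t :=
      Complex.ofRealCLM.hasDerivAt.const_sub z
    have h1 : HasDerivAt (resolventFun z) (resolventFun z t ^ 2) t := by
      have h := h0.fun_inv (sub_ofReal_ne_zero hz t)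
      have he : resolventFun z = fun t : ℝ => (z - (t : ℂ))⁻¹ := by
        funext t; simp [resolventFun]
      rw [he]
      refine h.congr_deriv ?_
      rw [neg_neg, one_div, inv_pow]
    rw [iteratedDeriv_succ, ih, ((h1.fun_pow (k + 1)).const_mul _).deriv, Nat.factorial_succ,
      Nat.add_sub_cancel]
    push_cast
    ring

lemma contDiff_resolventFun {z : ℂ} (hz : z.im ≠ 0) : ContDiff ℝ ∞ (resolventFun z) := by
  have he : resolventFun z = fun t : ℝ => (z - (t : ℂ))⁻¹ := by
    funext t; simp [resolventFun]
  rw [he]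
  exact (contDiff_const.sub Complex.ofRealCLM.contDiff).inv (sub_ofReal_ne_zero hz)

lemma derivBound_resolventFun {δ : ℝ} (hδ : 0 < δ) (m : ℕ) {z : ℂ} (hz : δ ≤ |z.im|) :
    DerivBound m (m.factorial * (1 + δ⁻¹) ^ (m + 1)) (resolventFun z) := by
  intro i hi t
  have hz0 : z.im ≠ 0 := abs_pos.1 (hδ.trans_le hz)
  have h1 : ‖resolventFun z t‖ ≤ 1 + δ⁻¹ := by
    rw [resolventFun, norm_div, norm_one, one_div]
    exact (inv_anti₀ hδ (hz.trans (abs_im_le_norm_sub_ofReal z t))).trans (by simp)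
  rw [iteratedDeriv_resolventFun hz0, norm_mul, norm_pow, Complex.norm_natCast]
  calc (i.factorial : ℝ) * ‖resolventFun z t‖ ^ (i + 1)
      ≤ m.factorial * (1 + δ⁻¹) ^ (i + 1) := by
        gcongr
    _ ≤ _ := by
        gcongr
        exact le_add_of_nonneg_right (inv_nonneg.2 hδ.le)

lemma smoothBdd_resolventFun {z : ℂ} (hz : z.im ≠ 0) : SmoothBdd (resolventFun z) :=
  smoothBdd_of_derivBound (contDiff_resolventFun hz) fun m =>
    ⟨_, derivBound_resolventFun (abs_pos.2 hz) m le_rfl⟩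

lemma opL_resolventFun {z : ℂ} (hz : z.im ≠ 0) :
    opL (resolventFun z) = (z ^ 2 - 4) • iteratedDeriv 1 (resolventFun z) +
      z • resolventFun z + fun _ => -2 := by
  have hd : deriv (resolventFun z) = iteratedDeriv 1 (resolventFun z) := iteratedDeriv_one.symm
  funext t
  have hne := sub_ofReal_ne_zero hz t
  simp only [opL, hd, iteratedDeriv_resolventFun hz, Pi.add_apply, Pi.smul_apply, smul_eq_mul,
    resolventFun, Nat.factorial_one, Nat.cast_one]
  generalize hu : z - (t : ℂ) = u at *
  obtain rfl : z = u + t := by rw [← hu]; ring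
  have hi : u * u⁻¹ = 1 := mul_inv_cancel₀ hne
  rw [one_div]
  linear_combination -(2 * (t : ℂ) * u⁻¹ + u * u⁻¹ + 2) * hi

/-! ### Bounded functionals on the smooth bounded functions -/

/-- Linear functionals on the smooth functions with bounded derivatives which are bounded by a
finite number of the seminorms `sup |g^{(i)}|`. -/
structure BddFunctional (Λ : (ℝ → ℂ) → ℂ) : Prop where
  map_add : ∀ {f g : ℝ → ℂ}, SmoothBdd f → SmoothBdd g → Λ (f + g) = Λ f + Λ g
  map_smul : ∀ {f : ℝ → ℂ} (c : ℂ), SmoothBdd f → Λ (c • f) = c * Λ f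
  exists_bound : ∃ (m : ℕ) (C : ℝ), 0 ≤ C ∧ ∀ (g : ℝ → ℂ) (B : ℝ),
    SmoothBdd g → DerivBound m B g → ‖Λ g‖ ≤ C * B

lemma bddFunctional_semicircleMean : BddFunctional semicircleMean where
  map_add hf hg := semicircleMean_add hf.1.continuous hg.1.continuous
  map_smul c _ := semicircleMean_const_smul c _
  exists_bound := ⟨0, 1, zero_le_one, fun g B _ hB => by
    rw [one_mul]
    exact norm_semicircleMean_le fun t => by simpa using hB 0 le_rfl t⟩

lemma BddFunctional.comp_opT {Λ : (ℝ → ℂ) → ℂ} (h : BddFunctional Λ) :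
    BddFunctional fun g => Λ (opT g) where
  map_add hf hg := by rw [opT_add hf.1 hg.1, h.map_add hf.opT hg.opT]
  map_smul c hf := by rw [opT_const_smul hf.1, h.map_smul c hf.opT]
  exists_bound := by
    obtain ⟨m, C, hC0, hC⟩ := h.exists_bound
    obtain ⟨D, hD0, hD⟩ := exists_derivBound_opT m
    refine ⟨m + 3, C * D, by positivity, fun g B hg hB => ?_⟩
    rw [mul_assoc]
    exact hC _ _ hg.opT (hD g B hg.1 hB)

lemma BddFunctional.comp_iteratedDeriv {Λ : (ℝ → ℂ) → ℂ} (h : BddFunctional Λ) (k : ℕ) :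
    BddFunctional fun g => Λ (iteratedDeriv k g) where
  map_add {f g} hf hg := by
    have : iteratedDeriv k (f + g) = iteratedDeriv k f + iteratedDeriv k g := by
      funext t
      exact iteratedDeriv_add (contDiff_infty.1 hf.1 k).contDiffAt
        (contDiff_infty.1 hg.1 k).contDiffAt
    rw [this, h.map_add (hf.iteratedDeriv k) (hg.iteratedDeriv k)]
  map_smul {f} c hf := by
    have : iteratedDeriv k (c • f) = c • iteratedDeriv k f := by
      funext t
      rw [iteratedDeriv_const_smul_field, Pi.smul_apply]
    rw [this, h.map_smul c (hf.iteratedDeriv k)]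
  exists_bound := by
    obtain ⟨m, C, hC0, hC⟩ := h.exists_bound
    refine ⟨m + k, C, hC0, fun g B hg hB => hC _ _ (hg.iteratedDeriv k) fun i hi t => ?_⟩
    rw [iteratedDeriv_iteratedDeriv]
    exact hB _ (by omega) t

lemma bddFunctional_eta (j : ℕ) : BddFunctional fun g => semicircleMean (opT^[j] g) := by
  induction j with
  | zero => exact bddFunctional_semicircleMean
  | succ j ih => exact ih.comp_opT

/-- Differentiation with respect to the spectral parameter: since
`g_x = g_z - (x - z) g_z² + (x - z)² g_z² g_x` and `g_z' = g_z²`, a bounded functional may be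
applied under the derivative. -/
lemma BddFunctional.hasDerivAt_resolventFun {Λ : (ℝ → ℂ) → ℂ} (h : BddFunctional Λ) {z : ℂ}
    (hz : z.im ≠ 0) :
    HasDerivAt (fun x => Λ (resolventFun x)) (-Λ (iteratedDeriv 1 (resolventFun z))) z := by
  obtain ⟨m, C, hC0, hC⟩ := h.exists_bound
  set δ := |z.im| / 2 with hδ
  have hδ0 : 0 < δ := by have := abs_pos.2 hz; positivity
  set g := resolventFun z with hg
  have hgs : SmoothBdd g := smoothBdd_resolventFun hz
  have hg2 : iteratedDeriv 1 g = g * g := by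
    rw [hg, iteratedDeriv_resolventFun hz]
    funext t
    simp only [Pi.mul_apply, Nat.factorial_one]
    push_cast
    ring
  obtain ⟨A, hA0, hA⟩ := (hgs.mul hgs).exists_derivBound m
  set K := C * (2 ^ m * (A * (m.factorial * (1 + δ⁻¹) ^ (m + 1)))) with hK
  have hnear : ∀ᶠ x in 𝓝 z, δ ≤ |x.im| := by
    have : Tendsto (fun x : ℂ => |x.im|) (𝓝 z) (𝓝 |z.im|) :=
      (Complex.continuous_im.abs).continuousAt
    exact this.eventually_const_le (by rw [hδ]; have := abs_pos.2 hz; linarith)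
  rw [hasDerivAt_iff_isLittleO]
  refine (Asymptotics.IsBigO.of_bound K ?_).trans_isLittleO
    (Asymptotics.isLittleO_pow_sub_sub z one_lt_two)
  filter_upwards [hnear] with x hx
  have hx0 : x.im ≠ 0 := abs_pos.1 (hδ0.trans_le hx)
  have hxs : SmoothBdd (resolventFun x) := smoothBdd_resolventFun hx0
  have hgx : SmoothBdd (g * g * resolventFun x) := (hgs.mul hgs).mul hxs
  have hdec : resolventFun x = g + ((-(x - z)) • (g * g) +
      (x - z) ^ 2 • (g * g * resolventFun x)) := by
    funext t
    have h1 := sub_ofReal_ne_zero hz t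
    have h2 := sub_ofReal_ne_zero hx0 t
    simp only [hg, Pi.add_apply, Pi.smul_apply, Pi.mul_apply, smul_eq_mul, resolventFun]
    field_simp
    ring
  have hval : Λ (resolventFun x) = Λ g + (-(x - z) * Λ (g * g) +
      (x - z) ^ 2 * Λ (g * g * resolventFun x)) := by
    conv_lhs => rw [hdec]
    rw [h.map_add hgs (((hgs.mul hgs).const_smul _).add (hgx.const_smul _)),
      h.map_add ((hgs.mul hgs).const_smul _) (hgx.const_smul _), h.map_smul _ (hgs.mul hgs),
      h.map_smul _ hgx]
  have hbd : ‖Λ (g * g * resolventFun x)‖ ≤ K :=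
    hC _ _ hgx (hA.mul (hgs.mul hgs).1 hxs.1 (derivBound_resolventFun hδ0 m hx))
  have heq : Λ (resolventFun x) - Λ g - (x - z) • (-Λ (iteratedDeriv 1 g)) =
      Λ (g * g * resolventFun x) * (x - z) ^ 2 := by
    rw [hval, hg2, smul_eq_mul]; ring
  rw [heq, norm_mul, norm_pow, norm_pow, norm_norm]
  exact mul_le_mul_of_nonneg_right hbd (by positivity)

lemma BddFunctional.exists_bound_resolventFun {Λ : (ℝ → ℂ) → ℂ} (h : BddFunctional Λ) {δ : ℝ}
    (hδ : 0 < δ) : ∃ K, ∀ z : ℂ, δ ≤ |z.im| → ‖Λ (resolventFun z)‖ ≤ K := by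
  obtain ⟨m, C, -, hC⟩ := h.exists_bound
  exact ⟨_, fun z hz => hC _ _ (smoothBdd_resolventFun (abs_pos.1 (hδ.trans_le hz)))
    (derivBound_resolventFun hδ m hz)⟩

lemma isOpen_im_ne_zero : IsOpen {z : ℂ | z.im ≠ 0} :=
  isOpen_ne_fun Complex.continuous_im continuous_const

/-- If `z ↦ Λ(g_z)` is known explicitly then so is `z ↦ Λ(g_z')`. -/
lemma BddFunctional.apply_deriv_eq {Λ : (ℝ → ℂ) → ℂ} (h : BddFunctional Λ) {F F' : ℂ → ℂ}
    (hF : ∀ z : ℂ, z.im ≠ 0 → Λ (resolventFun z) = F z)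
    (hF' : ∀ z : ℂ, z.im ≠ 0 → HasDerivAt F (F' z) z) {z : ℂ} (hz : z.im ≠ 0) :
    Λ (iteratedDeriv 1 (resolventFun z)) = -F' z := by
  have h1 := h.hasDerivAt_resolventFun hz
  have h2 : HasDerivAt (fun x => Λ (resolventFun x)) (F' z) z :=
    (hF' z hz).congr_of_eventuallyEq (eventually_of_mem (isOpen_im_ne_zero.mem_nhds hz) hF)
  rw [← h1.unique h2, neg_neg]

lemma BddFunctional.apply_iteratedDeriv_three_eq {Λ : (ℝ → ℂ) → ℂ} (h : BddFunctional Λ)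
    {F F₁ F₂ F₃ : ℂ → ℂ} (hF : ∀ z : ℂ, z.im ≠ 0 → Λ (resolventFun z) = F z)
    (h₁ : ∀ z : ℂ, z.im ≠ 0 → HasDerivAt F (F₁ z) z)
    (h₂ : ∀ z : ℂ, z.im ≠ 0 → HasDerivAt F₁ (F₂ z) z)
    (h₃ : ∀ z : ℂ, z.im ≠ 0 → HasDerivAt F₂ (F₃ z) z) {z : ℂ} (hz : z.im ≠ 0) :
    Λ (iteratedDeriv 3 (resolventFun z)) = -F₃ z := by
  have e1 : ∀ z : ℂ, z.im ≠ 0 → Λ (iteratedDeriv 1 (resolventFun z)) = -F₁ z :=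
    fun z hz => h.apply_deriv_eq hF h₁ hz
  have e2 : ∀ z : ℂ, z.im ≠ 0 → Λ (iteratedDeriv 2 (resolventFun z)) = F₂ z := fun z hz => by
    have := (h.comp_iteratedDeriv 1).apply_deriv_eq e1 (fun z hz => (h₂ z hz).fun_neg) hz
    simpa only [iteratedDeriv_iteratedDeriv, neg_neg] using this
  have := (h.comp_iteratedDeriv 2).apply_deriv_eq e2 h₃ hz
  simpa only [iteratedDeriv_iteratedDeriv] using this

/-! ### The branch of the square root -/

lemma one_sub_four_div_sq_mem_slitPlane {z : ℂ} (hz : z.im ≠ 0) :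
    1 - 4 / z ^ 2 ∈ Complex.slitPlane := by
  by_contra hcon
  rw [Complex.mem_slitPlane_iff_not_le_zero, not_not, Complex.le_def] at hcon
  obtain ⟨hre, him⟩ := hcon
  set x := (1 - 4 / z ^ 2).re with hx
  have hz0 : z ≠ 0 := fun h => hz (by simp [h])
  have h1 : 1 - 4 / z ^ 2 = (x : ℂ) := Complex.ext (by simp [hx]) (by simpa using him)
  have h2 : z ^ 2 * ((1 - x : ℝ) : ℂ) = 4 := by
    push_cast
    rw [← h1]
    field_simp
    ring
  have hx0 : x ≤ 0 := by simpa using hre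
  have hr := congrArg Complex.re h2
  have hi := congrArg Complex.im h2
  rw [Complex.re_mul_ofReal] at hr
  rw [Complex.im_mul_ofReal] at hi
  simp only [pow_two, Complex.mul_re, Complex.mul_im, Complex.re_ofNat, Complex.im_ofNat] at hr hi
  have h3 : z.re * z.im + z.im * z.re = 0 :=
    (mul_eq_zero.1 hi).resolve_right (by linarith)
  have h4 : z.re = 0 := by
    have : z.re * z.im = 0 := by linarith
    exact (mul_eq_zero.1 this).resolve_right hz
  rw [h4] at hr
  nlinarith [mul_self_nonneg z.im, mul_nonneg (mul_self_nonneg z.im) (by linarith : 0 ≤ 1 - x)]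

lemma sqrtBranch_sq {z : ℂ} (hz : z.im ≠ 0) : sqrtBranch z ^ 2 = z ^ 2 - 4 := by
  have hz0 : z ≠ 0 := fun h => hz (by simp [h])
  have h : ((1 - 4 / z ^ 2) ^ (1 / 2 : ℂ)) ^ 2 = 1 - 4 / z ^ 2 := by
    rw [← Complex.cpow_nat_mul]; norm_num
  rw [sqrtBranch, mul_pow, h]
  field_simp

lemma sqrtBranch_ne_zero {z : ℂ} (hz : z.im ≠ 0) : sqrtBranch z ≠ 0 := by
  have hz0 : z ≠ 0 := fun h => hz (by simp [h])
  rw [sqrtBranch]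
  refine mul_ne_zero hz0 ?_
  rw [Complex.cpow_ne_zero_iff]
  exact Or.inl (Complex.slitPlane_ne_zero (one_sub_four_div_sq_mem_slitPlane hz))

lemma hasDerivAt_sqrtBranch {z : ℂ} (hz : z.im ≠ 0) :
    HasDerivAt sqrtBranch (z / sqrtBranch z) z := by
  have hz0 : z ≠ 0 := fun h => hz (by simp [h])
  have hd : DifferentiableAt ℂ sqrtBranch z := by
    have h1 : DifferentiableAt ℂ (fun z : ℂ => 1 - 4 / z ^ 2) z :=
      (differentiableAt_const _).sub ((differentiableAt_const _).div
        (differentiableAt_id.pow 2) (pow_ne_zero 2 hz0))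
    exact differentiableAt_id.mul (h1.cpow (differentiableAt_const _)
      (one_sub_four_div_sq_mem_slitPlane hz))
  have h1 : HasDerivAt (fun x => sqrtBranch x ^ 2) (2 * sqrtBranch z * deriv sqrtBranch z) z := by
    simpa using hd.hasDerivAt.fun_pow 2
  have h2 : HasDerivAt (fun x => sqrtBranch x ^ 2) (2 * z) z := by
    have h3 : HasDerivAt (fun x : ℂ => x ^ 2 - 4) (2 * z) z := by
      simpa using (hasDerivAt_pow 2 z).sub_const (4 : ℂ)
    exact h3.congr_of_eventuallyEq
      (eventually_of_mem (isOpen_im_ne_zero.mem_nhds hz) fun x hx => sqrtBranch_sq hx)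
  have h4 := h1.unique h2
  have hw := sqrtBranch_ne_zero hz
  have h5 : deriv sqrtBranch z = z / sqrtBranch z := by
    rw [eq_div_iff hw]
    linear_combination h4 / 2
  exact h5 ▸ hd.hasDerivAt

lemma tendsto_sqrtBranch_div : Tendsto (fun z => sqrtBranch z / z) (cobounded ℂ) (𝓝 1) := by
  have h1 : Tendsto (fun z : ℂ => 1 - 4 / z ^ 2) (cobounded ℂ) (𝓝 1) := by
    have := ((tendsto_inv₀_cobounded (α := ℂ)).pow 2).const_mul 4 |>.const_sub 1
    simpa [div_eq_mul_inv] using this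
  have h2 := h1.cpow (tendsto_const_nhds (x := (1 / 2 : ℂ))) Complex.one_mem_slitPlane
  rw [Complex.one_cpow] at h2
  refine h2.congr' ?_
  filter_upwards [eventually_ne_cobounded (0 : ℂ)] with z hz
  rw [sqrtBranch, mul_div_cancel_left₀ _ hz]

/-- `w(z)^{-m}`, where `w = sqrtBranch`. -/
noncomputable def invPow (m : ℤ) (z : ℂ) : ℂ := sqrtBranch z ^ (-m)

lemma invPow_add_two {z : ℂ} (hz : z.im ≠ 0) (m : ℤ) :
    (z ^ 2 - 4) * invPow (m + 2) z = invPow m z := by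
  rw [← sqrtBranch_sq hz, invPow, invPow, ← zpow_natCast, ← zpow_add₀ (sqrtBranch_ne_zero hz)]
  congr 1
  push_cast
  ring

lemma hasDerivAt_invPow {z : ℂ} (hz : z.im ≠ 0) (m : ℤ) :
    HasDerivAt (invPow m) (-m * z * invPow (m + 2) z) z := by
  have hw := sqrtBranch_ne_zero hz
  have h := (hasDerivAt_zpow (-m) (sqrtBranch z) (Or.inl hw)).comp z (hasDerivAt_sqrtBranch hz)
  refine h.congr_deriv ?_
  have h1 : sqrtBranch z ^ (-m - 1) = sqrtBranch z ^ (-(m + 2)) * sqrtBranch z := by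
    rw [← zpow_add_one₀ hw]; congr 1; ring
  rw [h1, invPow]
  push_cast
  field_simp

lemma hasDerivAt_invPow₂ {z : ℂ} (hz : z.im ≠ 0) (m : ℤ) :
    HasDerivAt (fun z => -m * z * invPow (m + 2) z)
      (m * (m + 1) * invPow (m + 2) z + 4 * m * (m + 2) * invPow (m + 4) z) z := by
  have h0 : HasDerivAt (fun z : ℂ => -(m : ℂ) * z) (-m) z := by
    simpa using (hasDerivAt_id z).const_mul (-(m : ℂ))
  refine (h0.fun_mul (hasDerivAt_invPow hz (m + 2))).congr_deriv ?_
  have h1 := invPow_add_two hz (m + 2)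
  rw [show m + 2 + 2 = m + 4 by ring] at h1 ⊢
  push_cast
  linear_combination (m : ℂ) * (m + 2) * h1

lemma hasDerivAt_invPow₃ {z : ℂ} (hz : z.im ≠ 0) (m : ℤ) :
    HasDerivAt (fun z => m * (m + 1) * invPow (m + 2) z + 4 * m * (m + 2) * invPow (m + 4) z)
      (-z * (m * (m + 1) * (m + 2) * invPow (m + 4) z +
        4 * m * (m + 2) * (m + 4) * invPow (m + 6) z)) z := by
  refine (((hasDerivAt_invPow hz (m + 2)).const_mul ((m : ℂ) * (m + 1))).fun_add
    ((hasDerivAt_invPow hz (m + 4)).const_mul (4 * (m : ℂ) * (m + 2)))).congr_deriv ?_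
  rw [show m + 2 + 2 = m + 4 by ring, show m + 4 + 2 = m + 6 by ring]
  push_cast
  ring

lemma tendsto_invPow_div (m : ℕ) : Tendsto (fun z => invPow m z / z) (cobounded ℂ) (𝓝 0) := by
  have h1 := tendsto_sqrtBranch_div.inv₀ one_ne_zero
  have h2 : Tendsto (fun z : ℂ => z⁻¹) (cobounded ℂ) (𝓝 0) := tendsto_inv₀_cobounded
  have h3 := ((h1.mul h2).pow m).mul h2
  rw [mul_zero] at h3
  refine h3.congr' ?_
  filter_upwards [eventually_ne_cobounded (0 : ℂ)] with z hz
  have h4 : (sqrtBranch z / z)⁻¹ * z⁻¹ = (sqrtBranch z)⁻¹ := by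
    rw [inv_div, div_mul_eq_mul_div, mul_inv_cancel₀ hz, one_div]
  rw [h4, invPow, zpow_neg, zpow_natCast, inv_pow, div_eq_mul_inv _ z]

/-! ### The differential equations of the coefficients -/

/-- A solution of the homogeneous equation `(z² - 4) d' = z d` is a locally constant multiple of
`w(z)`, so it vanishes if it is `o(z)` along rays. -/
lemma eq_zero_of_homogeneous_ode {d d' : ℂ → ℂ} (hd : ∀ z : ℂ, z.im ≠ 0 → HasDerivAt d (d' z) z)
    (hode : ∀ z : ℂ, z.im ≠ 0 → (z ^ 2 - 4) * d' z = z * d z) {z : ℂ} (hz : z.im ≠ 0)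
    (hlim : Tendsto (fun x : ℝ => d (Real.exp x * z) / (Real.exp x * z)) atTop (𝓝 0))
    (hray : Tendsto (fun x : ℝ => (Real.exp x : ℂ) * z) atTop (cobounded ℂ)) : d z = 0 := by
  have him : ∀ x : ℝ, ((Real.exp x : ℂ) * z).im ≠ 0 := fun x => by
    rw [Complex.im_ofReal_mul]
    exact mul_ne_zero (Real.exp_pos x).ne' hz
  -- along the ray `x ↦ e^x z`, which stays off the real axis, the quotient `d / w` is constant
  set φ : ℝ → ℂ := fun x => d (Real.exp x * z) / sqrtBranch (Real.exp x * z) with hφ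
  have hφ' : ∀ x, HasDerivAt φ 0 x := by
    intro x
    have hr : HasDerivAt (fun x : ℝ => (Real.exp x : ℂ) * z) ((Real.exp x : ℂ) * z) x :=
      ((Real.hasDerivAt_exp x).ofReal_comp).mul_const z
    have hw := sqrtBranch_ne_zero (him x)
    have hw2 := sqrtBranch_sq (him x)
    have hq := ((hd _ (him x)).fun_div (hasDerivAt_sqrtBranch (him x)) hw).comp x hr
    refine hq.congr_deriv ?_
    have ho := hode _ (him x)
    rw [← hw2] at ho
    have : d' (Real.exp x * z) * sqrtBranch (Real.exp x * z) -
        d (Real.exp x * z) * (Real.exp x * z / sqrtBranch (Real.exp x * z)) = 0 := by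
      field_simp
      linear_combination ho
    rw [this, zero_div, zero_mul]
  have hconst : ∀ x, φ x = φ 0 := fun x =>
    is_const_of_deriv_eq_zero (fun x => (hφ' x).differentiableAt) (fun x => (hφ' x).deriv) x 0
  have hφlim : Tendsto φ atTop (𝓝 0) := by
    have h := hlim.div (tendsto_sqrtBranch_div.comp hray) one_ne_zero
    rw [zero_div] at h
    refine h.congr fun x => ?_
    have hne : (Real.exp x : ℂ) * z ≠ 0 := fun h => him x (by rw [h]; simp)
    simp only [Function.comp_apply, hφ, Pi.div_apply]
    rw [div_div_div_cancel_right₀ hne]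
  have h0 : φ 0 = 0 :=
    tendsto_nhds_unique (tendsto_const_nhds.congr fun x => (hconst x).symm) hφlim
  have hw := sqrtBranch_ne_zero hz
  simpa [hφ, hw] using h0

/-- A bounded functional whose values on resolvents satisfy `(z² - 4) E' - z E = R` is
determined on them by any solution of this equation that is `o(z)` at infinity. -/
lemma BddFunctional.apply_resolventFun_eq {Λ : (ℝ → ℂ) → ℂ} (h : BddFunctional Λ)
    {V V' R : ℂ → ℂ}
    (hΛ : ∀ z : ℂ, z.im ≠ 0 → (z ^ 2 - 4) * Λ (iteratedDeriv 1 (resolventFun z)) +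
      z * Λ (resolventFun z) = -R z)
    (hV : ∀ z : ℂ, z.im ≠ 0 → HasDerivAt V (V' z) z)
    (hode : ∀ z : ℂ, z.im ≠ 0 → (z ^ 2 - 4) * V' z - z * V z = R z)
    (hlim : Tendsto (fun z => V z / z) (cobounded ℂ) (𝓝 0)) {z : ℂ} (hz : z.im ≠ 0) :
    Λ (resolventFun z) = V z := by
  have hz0 : z ≠ 0 := fun h => hz (by simp [h])
  have hray : Tendsto (fun x : ℝ => (Real.exp x : ℂ) * z) atTop (cobounded ℂ) := by
    rw [← tendsto_norm_atTop_iff_cobounded]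
    simp only [norm_mul, Complex.norm_real, Real.norm_eq_abs, Real.abs_exp]
    exact Real.tendsto_exp_atTop.atTop_mul_const (norm_pos_iff.2 hz0)
  have key := eq_zero_of_homogeneous_ode (d := fun z => Λ (resolventFun z) - V z)
    (d' := fun z => -Λ (iteratedDeriv 1 (resolventFun z)) - V' z)
    (fun z hz => (h.hasDerivAt_resolventFun hz).fun_sub (hV z hz))
    (fun z hz => by linear_combination -hΛ z hz - hode z hz) hz ?_ hray
  · exact sub_eq_zero.1 key
  · obtain ⟨K, hK⟩ := h.exists_bound_resolventFun (abs_pos.2 hz)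
    have h1 : Tendsto (fun x : ℝ => Λ (resolventFun (Real.exp x * z)) * (Real.exp x * z)⁻¹) atTop
        (𝓝 0) := by
      refine isBoundedUnder_le_mul_tendsto_zero ?_ (tendsto_inv₀_cobounded.comp hray)
      refine isBoundedUnder_of_eventually_le (a := K) ?_
      filter_upwards [eventually_ge_atTop 0] with x hx
      refine hK _ ?_
      rw [Complex.im_ofReal_mul, abs_mul, Real.abs_exp]
      exact le_mul_of_one_le_left (abs_nonneg _) (Real.one_le_exp hx)
    have h2 := h1.sub (hlim.comp hray)
    rw [sub_zero] at h2
    refine h2.congr fun x => ?_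
    simp only [Function.comp_apply]
    rw [sub_div, div_eq_mul_inv (Λ _)]

lemma eta_zero_eq {z : ℂ} (hz : z.im ≠ 0) : eta 0 z = z / 2 - 1 / 2 * sqrtBranch z := by
  refine bddFunctional_semicircleMean.apply_resolventFun_eq (V := fun z => z / 2 - 1 / 2 *
    sqrtBranch z) (V' := fun z => 1 / 2 - 1 / 2 * (z / sqrtBranch z)) (R := fun _ => -2) ?_ ?_ ?_ ?_
    hz
  · intro z hz
    have hg := smoothBdd_resolventFun hz
    have h := semicircleMean_opL hg.1
    rw [opL_resolventFun hz, bddFunctional_semicircleMean.map_add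
      (((hg.iteratedDeriv 1).const_smul _).add (hg.const_smul _)) (smoothBdd_const _),
      bddFunctional_semicircleMean.map_add ((hg.iteratedDeriv 1).const_smul _) (hg.const_smul _),
      semicircleMean_const_smul, semicircleMean_const_smul, semicircleMean_const] at h
    linear_combination h
  · intro z hz
    exact ((hasDerivAt_id z).div_const 2).fun_sub ((hasDerivAt_sqrtBranch hz).const_mul _)
  · intro z hz
    have hw := sqrtBranch_ne_zero hz
    have h2 := sqrtBranch_sq hz
    have h3 : (z ^ 2 - 4) * (z / sqrtBranch z) = z * sqrtBranch z := by
      rw [← h2]; field_simp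
    linear_combination -1 / 2 * h3
  · have h := (tendsto_sqrtBranch_div.const_sub 1).const_mul (1 / 2)
    rw [sub_self, mul_zero] at h
    refine h.congr' ?_
    filter_upwards [eventually_ne_cobounded (0 : ℂ)] with z hz
    field_simp

/-- The equation `(z² - 4) η_{j+1}' - z η_{j+1} = η_j'''` determines `η_{j+1}` from `η_j`. -/
lemma eta_succ_eq {j : ℕ} {F F₁ F₂ F₃ V V' : ℂ → ℂ} (hF : ∀ z : ℂ, z.im ≠ 0 → eta j z = F z)
    (h₁ : ∀ z : ℂ, z.im ≠ 0 → HasDerivAt F (F₁ z) z)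
    (h₂ : ∀ z : ℂ, z.im ≠ 0 → HasDerivAt F₁ (F₂ z) z)
    (h₃ : ∀ z : ℂ, z.im ≠ 0 → HasDerivAt F₂ (F₃ z) z)
    (hV : ∀ z : ℂ, z.im ≠ 0 → HasDerivAt V (V' z) z)
    (hode : ∀ z : ℂ, z.im ≠ 0 → (z ^ 2 - 4) * V' z - z * V z = F₃ z)
    (hlim : Tendsto (fun z => V z / z) (cobounded ℂ) (𝓝 0)) {z : ℂ} (hz : z.im ≠ 0) :
    eta (j + 1) z = V z := by
  refine (bddFunctional_eta (j + 1)).apply_resolventFun_eq (fun z hz => ?_) hV hode hlim hz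
  have hΛ := bddFunctional_eta (j + 1)
  have hg := smoothBdd_resolventFun hz
  have h1 : semicircleMean (opT^[j + 1] (opL (resolventFun z))) = -F₃ z := by
    rw [Function.iterate_succ_apply, opT_opL hg.1]
    exact (bddFunctional_eta j).apply_iteratedDeriv_three_eq hF h₁ h₂ h₃ hz
  have h0 : semicircleMean (opT^[j + 1] fun _ => (-2 : ℂ)) = 0 := by
    have h2 : (0 : ℝ → ℂ) = (0 : ℂ) • fun _ => (0 : ℂ) := by simp
    rw [Function.iterate_succ_apply, opT_const, h2]
    have := (bddFunctional_eta j).map_smul 0 (smoothBdd_const 0)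
    rwa [zero_mul] at this
  have h2 := hΛ.map_add (((hg.iteratedDeriv 1).const_smul (z ^ 2 - 4)).add (hg.const_smul z))
    (smoothBdd_const (-2))
  have h3 := hΛ.map_add ((hg.iteratedDeriv 1).const_smul (z ^ 2 - 4)) (hg.const_smul z)
  have h4 := hΛ.map_smul (z ^ 2 - 4) (hg.iteratedDeriv 1)
  have h5 := hΛ.map_smul z hg
  rw [← opL_resolventFun hz] at h2
  rw [h1, h0, h3, h4, h5] at h2
  linear_combination -h2

lemma eta_one_eq {z : ℂ} (hz : z.im ≠ 0) : eta 1 z = invPow 5 z := by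
  refine eta_succ_eq (F := fun z => z / 2 - 1 / 2 * invPow (-1) z)
    (F₁ := fun z => 1 / 2 - 1 / 2 * (-(-1 : ℤ) * z * invPow (-1 + 2) z))
    (F₂ := fun z => -(1 / 2 * ((-1 : ℤ) * ((-1 : ℤ) + 1) * invPow (-1 + 2) z +
      4 * (-1 : ℤ) * ((-1 : ℤ) + 2) * invPow (-1 + 4) z)))
    (F₃ := fun z => -(1 / 2 * (-z * ((-1 : ℤ) * ((-1 : ℤ) + 1) * ((-1 : ℤ) + 2) * invPow (-1 + 4) z
      + 4 * (-1 : ℤ) * ((-1 : ℤ) + 2) * ((-1 : ℤ) + 4) * invPow (-1 + 6) z))))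
    (fun z hz => by rw [eta_zero_eq hz, invPow]; simp)
    (fun z hz => ((hasDerivAt_id z).div_const 2).fun_sub ((hasDerivAt_invPow hz (-1)).const_mul _))
    (fun z hz => ((hasDerivAt_invPow₂ hz (-1)).const_mul _).const_sub _)
    (fun z hz => ((hasDerivAt_invPow₃ hz (-1)).const_mul _).fun_neg)
    (fun z hz => hasDerivAt_invPow hz 5)
    (fun z hz => ?_) (by exact_mod_cast tendsto_invPow_div 5) hz
  have h := invPow_add_two hz 5
  push_cast
  norm_num
  norm_num at h
  linear_combination -5 * z * h

/-! ### The recursion for the constants -/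

/-- The numbers `C_{j,r}`. Only `j ≥ 1` is meaningful; the recursion makes them vanish for `r`
outside `[2j, 3j - 1]`. -/
noncomputable def expansionCoeff : ℕ → ℕ → ℝ
  | 0, _ => 0
  | 1, r => if r = 2 then 1 else 0
  | j + 2, r => (2 * (r : ℝ) - 3) * (2 * (r : ℝ) - 1) / ((r : ℝ) + 1) *
      (((r : ℝ) - 1) * expansionCoeff (j + 1) (r - 2) +
        (4 * (r : ℝ) - 10) * expansionCoeff (j + 1) (r - 3))

lemma expansionCoeff_succ {j : ℕ} (hj : 1 ≤ j) (r : ℕ) :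
    expansionCoeff (j + 1) r = (2 * (r : ℝ) - 3) * (2 * (r : ℝ) - 1) / ((r : ℝ) + 1) *
      (((r : ℝ) - 1) * expansionCoeff j (r - 2) +
        (4 * (r : ℝ) - 10) * expansionCoeff j (r - 3)) := by
  obtain ⟨j, rfl⟩ := Nat.exists_eq_add_of_le' hj
  rw [expansionCoeff]

lemma expansionCoeff_eq_zero {j : ℕ} (hj : 1 ≤ j) {r : ℕ} (hr : r < 2 * j ∨ 3 * j ≤ r) :
    expansionCoeff j r = 0 := by
  induction j, hj using Nat.le_induction generalizing r with
  | base => rw [expansionCoeff, if_neg (by omega)]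
  | succ j hj ih =>
    rw [expansionCoeff_succ hj, ih (r := r - 2) (by omega), ih (r := r - 3) (by omega)]
    simp

lemma sum_expansionCoeff {j N : ℕ} (hj : 1 ≤ j) (hN : 3 * j ≤ N) (u : ℕ → ℂ) :
    ∑ r ∈ Finset.Icc (2 * j) (3 * j - 1), (expansionCoeff j r : ℂ) * u r =
      ∑ r ∈ Finset.range N, (expansionCoeff j r : ℂ) * u r := by
  refine Finset.sum_subset (fun r hr => ?_) fun r _ hr => ?_
  · rw [Finset.mem_Icc] at hr
    rw [Finset.mem_range]
    omega
  · rw [Finset.mem_Icc] at hr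
    rw [expansionCoeff_eq_zero hj (by omega)]
    simp

/-- The recursion as a substitution in generating sums: each `u r` is replaced by the combination
of `u (r + 2)` and `u (r + 3)` that it contributes to. -/
lemma sum_expansionCoeff_succ {j N : ℕ} (hj : 1 ≤ j) (hN : 3 * j ≤ N) (u : ℕ → ℂ) :
    ∑ r ∈ Finset.range (N + 3), (expansionCoeff (j + 1) r : ℂ) * u r =
      ∑ r ∈ Finset.range N, (expansionCoeff j r : ℂ) *
        ((2 * r + 1) * (2 * r + 3) * (r + 1) / (r + 3) * u (r + 2) +
          (2 * r + 3) * (2 * r + 5) * (4 * r + 2) / (r + 4) * u (r + 3)) := by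
  have hz : ∀ r, r < 2 * (j + 1) → expansionCoeff (j + 1) r = 0 := fun r hr =>
    expansionCoeff_eq_zero (by omega) (Or.inl hr)
  rw [Finset.sum_range_succ', Finset.sum_range_succ', Finset.sum_range_succ', hz 0 (by omega),
    hz (0 + 1) (by omega), hz (0 + 1 + 1) (by omega)]
  have h1 : ∑ r ∈ Finset.range N, (expansionCoeff j (r + 1) : ℂ) *
      ((2 * (r + 1 : ℕ) + 1) * (2 * (r + 1 : ℕ) + 3) * ((r + 1 : ℕ) + 1) / ((r + 1 : ℕ) + 3) *
        u (r + 1 + 2)) = ∑ r ∈ Finset.range N, (expansionCoeff j r : ℂ) *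
      ((2 * r + 1) * (2 * r + 3) * (r + 1) / (r + 3) * u (r + 2)) := by
    have h2 := Finset.sum_range_succ' (fun r : ℕ => (expansionCoeff j r : ℂ) *
      ((2 * r + 1) * (2 * r + 3) * (r + 1) / (r + 3) * u (r + 2))) N
    rw [Finset.sum_range_succ, expansionCoeff_eq_zero hj (Or.inr hN),
      expansionCoeff_eq_zero hj (Or.inl (by omega) : 0 < 2 * j ∨ _)] at h2
    simpa using h2.symm
  rw [Finset.sum_congr rfl fun r _ => mul_add (expansionCoeff j r : ℂ) _ _, Finset.sum_add_distrib,
    ← h1, ← Finset.sum_add_distrib]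
  simp only [Complex.ofReal_zero, zero_mul, add_zero]
  refine Finset.sum_congr rfl fun r _ => ?_
  rw [expansionCoeff_succ hj, show r + 1 + 1 + 1 - 2 = r + 1 by omega,
    show r + 1 + 1 + 1 - 3 = r by omega, show r + 1 + 2 = r + 3 by omega,
    show r + 1 + 1 + 1 = r + 3 by omega]
  have h4 : (r : ℂ) + 4 ≠ 0 := by exact_mod_cast (by omega : r + 4 ≠ 0)
  have h5 : (r : ℂ) + 3 + 1 ≠ 0 := by exact_mod_cast (by omega : r + 3 + 1 ≠ 0)
  have h6 : (r : ℂ) + 1 + 3 ≠ 0 := by exact_mod_cast (by omega : r + 1 + 3 ≠ 0)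
  push_cast
  field_simp
  ring

/-- The induction step solves the equation for `η_{j+1}` term by term: the third derivative of
`w^{-2r-1}` is `(z² - 4) V' - z V` for a combination `V` of `w^{-2r-5}` and `w^{-2r-7}`. -/
lemma eta_eq_sum {j : ℕ} (hj : 1 ≤ j) {z : ℂ} (hz : z.im ≠ 0) :
    eta j z = ∑ r ∈ Finset.range (3 * j), (expansionCoeff j r : ℂ) * invPow (2 * r + 1) z := by
  induction j, hj using Nat.le_induction generalizing z with
  | base =>
    rw [eta_one_eq hz]
    simp [Finset.sum_range_succ, expansionCoeff]
  | succ j hj ih =>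
    rw [Nat.mul_succ, sum_expansionCoeff_succ hj le_rfl]
    refine eta_succ_eq
      (F := fun z => ∑ r ∈ Finset.range (3 * j), (expansionCoeff j r : ℂ) * invPow (2 * r + 1) z)
      (V := fun z => ∑ r ∈ Finset.range (3 * j), (expansionCoeff j r : ℂ) *
        ((2 * r + 1) * (2 * r + 3) * (r + 1) / (r + 3) * invPow (2 * (r + 2 : ℕ) + 1) z +
          (2 * r + 3) * (2 * r + 5) * (4 * r + 2) / (r + 4) * invPow (2 * (r + 3 : ℕ) + 1) z))
      (fun z hz => ih hz)
      (fun z hz => HasDerivAt.fun_sum fun r _ => (hasDerivAt_invPow hz _).const_mul _)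
      (fun z hz => HasDerivAt.fun_sum fun r _ => (hasDerivAt_invPow₂ hz _).const_mul _)
      (fun z hz => HasDerivAt.fun_sum fun r _ => (hasDerivAt_invPow₃ hz _).const_mul _)
      (fun z hz => HasDerivAt.fun_sum fun r _ => (((hasDerivAt_invPow hz _).const_mul _).fun_add
        ((hasDerivAt_invPow hz _).const_mul _)).const_mul _)
      (fun z hz => ?_) ?_ hz
    · simp only [Finset.mul_sum]
      rw [← Finset.sum_sub_distrib]
      refine Finset.sum_congr rfl fun r _ => ?_
      have h1 := invPow_add_two hz (2 * (r + 2 : ℕ) + 1)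
      have h2 := invPow_add_two hz (2 * (r + 3 : ℕ) + 1)
      have e1 : (2 * (r : ℤ) + 1 + 4) = 2 * (r + 2 : ℕ) + 1 := by push_cast; ring
      have e2 : (2 * (r : ℤ) + 1 + 6) = 2 * (r + 3 : ℕ) + 1 := by push_cast; ring
      rw [e1, e2]
      have h3 : (r : ℂ) + 3 ≠ 0 := by exact_mod_cast (by omega : r + 3 ≠ 0)
      have h4 : (r : ℂ) + 4 ≠ 0 := by exact_mod_cast (by omega : r + 4 ≠ 0)
      generalize invPow (2 * (r + 2 : ℕ) + 1) z = A at *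
      generalize invPow (2 * (r + 3 : ℕ) + 1) z = B at *
      generalize invPow (2 * (r + 2 : ℕ) + 1 + 2) z = A' at *
      generalize invPow (2 * (r + 3 : ℕ) + 1 + 2) z = B' at *
      rw [← h1, ← h2]
      push_cast
      field_simp
      ring
    · simp only [Finset.sum_div]
      rw [show (0 : ℂ) = ∑ r ∈ Finset.range (3 * j), (0 : ℂ) by simp]
      refine tendsto_finsetSum _ fun r _ => ?_
      have h1 := tendsto_invPow_div (2 * (r + 2) + 1)
      have h2 := tendsto_invPow_div (2 * (r + 3) + 1)
      have h3 := ((h1.const_mul ((2 * r + 1) * (2 * r + 3) * (r + 1) / (r + 3) : ℂ)).add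
        (h2.const_mul ((2 * r + 3) * (2 * r + 5) * (4 * r + 2) / (r + 4) : ℂ))).const_mul
          (expansionCoeff j r : ℂ)
      rw [mul_zero, mul_zero, add_zero, mul_zero] at h3
      refine h3.congr fun z => ?_
      push_cast
      ring

lemma cauchyTransform_expansion {z : ℂ} (hz : z.im ≠ 0) (k : ℕ) : ∃ K : ℝ, ∀ n : ℕ, 1 ≤ n →
    ‖cauchyTransform n z - ∑ j ∈ Finset.range (k + 1), eta j z / (n : ℂ) ^ (2 * j)‖
      ≤ K / (n : ℝ) ^ (2 * k + 2) := by
  have hg := smoothBdd_resolventFun hz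
  obtain ⟨K, hK⟩ := (hg.opT_iterate (k + 1)).2 0
  refine ⟨K, fun n hn => ?_⟩
  have h := gueMean_expansion hn hg (k + 1)
  have h1 : cauchyTransform n z - ∑ j ∈ Finset.range (k + 1), eta j z / (n : ℂ) ^ (2 * j) =
      gueMean n (opT^[k + 1] (resolventFun z)) / (n : ℂ) ^ (2 * k + 2) := by
    rw [show cauchyTransform n z = gueMean n (resolventFun z) from rfl, h,
      show 2 * (k + 1) = 2 * k + 2 by ring]
    simp only [eta]
    ring
  rw [h1, norm_div, norm_pow, Complex.norm_natCast]
  gcongr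
  exact norm_gueMean_le hn fun t => by simpa using hK t

end GUEExpansion

theorem mainTheorem3 :
    -- the asymptotic expansion of the Cauchy transform, with coefficients `η_j`
    (∀ z : ℂ, z.im ≠ 0 → ∀ k : ℕ, ∃ K : ℝ, ∀ n : ℕ, 1 ≤ n →
      ‖GUEExpansion.cauchyTransform n z -
          ∑ j ∈ Finset.range (k + 1), GUEExpansion.eta j z / (n : ℂ) ^ (2 * j)‖
        ≤ K / (n : ℝ) ^ (2 * k + 2)) ∧
    -- the explicit form of `η_0` and `η_1`
    (∀ z : ℂ, z.im ≠ 0 →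
      GUEExpansion.eta 0 z = z / 2 - 1 / 2 * GUEExpansion.sqrtBranch z) ∧
    (∀ z : ℂ, z.im ≠ 0 →
      GUEExpansion.eta 1 z = GUEExpansion.sqrtBranch z ^ (-5 : ℤ)) ∧
    -- the general form of `η_j`, and the recursion formula for the constants
    ∃ C : ℕ → ℕ → ℝ,
      (∀ j : ℕ, 1 ≤ j → ∀ z : ℂ, z.im ≠ 0 →
        GUEExpansion.eta j z =
          ∑ r ∈ Finset.Icc (2 * j) (3 * j - 1),
            (C j r : ℂ) * GUEExpansion.sqrtBranch z ^ (-(2 * (r : ℤ) + 1))) ∧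
      (∀ j : ℕ, 1 ≤ j → C j (2 * j - 1) = 0 ∧ C j (3 * j) = 0) ∧
      (∀ j : ℕ, 1 ≤ j → ∀ r : ℕ, 2 * j + 2 ≤ r → r ≤ 3 * j + 2 →
        C (j + 1) r =
          (2 * (r : ℝ) - 3) * (2 * (r : ℝ) - 1) / ((r : ℝ) + 1) *
            (((r : ℝ) - 1) * C j (r - 2) + (4 * (r : ℝ) - 10) * C j (r - 3))) := by
  refine ⟨fun z hz k => GUEExpansion.cauchyTransform_expansion hz k,
    fun z hz => GUEExpansion.eta_zero_eq hz, fun z hz => GUEExpansion.eta_one_eq hz,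
    GUEExpansion.expansionCoeff, fun j hj z hz => ?_, fun j hj => ?_, fun j hj r _ _ => ?_⟩
  · rw [GUEExpansion.eta_eq_sum hj hz]
    exact (GUEExpansion.sum_expansionCoeff hj le_rfl
      fun r => GUEExpansion.invPow (2 * r + 1) z).symm
  · exact ⟨GUEExpansion.expansionCoeff_eq_zero hj (Or.inl (by omega)),
      GUEExpansion.expansionCoeff_eq_zero hj (Or.inr le_rfl)⟩
  · exact GUEExpansion.expansionCoeff_succ hj r
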